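/- Let $\mathbb T=\mathbb R/\mathbb Z$ be the circle with Haar (Lebesgue) probability measure $\lambda$, let $\alpha\in\mathbb R$ be irrational, let $R_\alpha(x)=x+\alpha$ be the corresponding irrational rotation, let $h:\mathbb T\to\mathbb T$ be a homeomorphism, and let $\phi=h\circ R_\alpha\circ h^{-1}$. Let $C(\mathbb T)\rtimes_\phi\mathbb Z$ be the crossed product $C^*$-algebra, i.e. the universal $C^*$-algebra generated by a copy of $C(\mathbb T)$ and a unitary $U$ such that $UfU^*=f\circ\phi^{-1}$ for all $f\in C(\mathbb T)$. Let $F:\mathbb T\to\mathbb R$ be continuous, and let $\alpha^F=(\alpha^F_t)_{t\in\mathbb R}$ be the flow on $C(\mathbb T)\rtimes_\phi\mathbb Z$ determined by $\alpha^F_t(fU)=fUe^{-itF}$ for $f\in C(\mathbb T)$. For $\beta\in\mathbb R$, a state $\omega$ on $C(\mathbb T)\rtimes_\phi\mathbb Z$ is a $\beta$-KMS state for $\alpha^F$ when there is a dense $\alpha^F$-invariant $*$-algebra of entire $\alpha^F$-analytic elements such that $\omega(ab)=\omega(b\,\alpha^F_{i\beta}(a))$ for all $a,b$ in it. Then: 1.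 There is a $\beta$-KMS state for $\alpha^F$ for some $\beta\neq 0$ if and only if $\int_{\mathbb T}F\circ h\,d\lambda=0$. 2. If $\int_{\mathbb T}F\circ h\,d\lambda=0$, then there is a $\beta$-KMS state for $\alpha^F$ for every $\beta\in\mathbb R$. 3. If $F$ has bounded variation on $\mathbb T$, then for each $\beta\in\mathbb R$ there is at most one $\beta$-KMS state for $\alpha^F$. In particular, if moreover $\int_{\mathbb T}F\circ h\,d\lambda=0$, there is exactly one $\beta$-KMS state for each $\beta\in\mathbb R$. -/

import Mathlib

open scoped ENNReal ComplexOrder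

universe u

noncomputable section

section CrossedProduct

variable {X : Type u} [TopologicalSpace X]

/-- A covariant representation of `(X, φ)` in a unital C*-algebra `B`: a unital `*`-homomorphism
`π : C(X) → B` and a unitary `u ∈ B` with `u π(f) u* = π(f ∘ φ⁻¹)`. -/
structure CovariantRep (φ : X ≃ₜ X) where
  B : Type u
  [cstar : CStarAlgebra B]
  [nontriv : Nontrivial B]
  π : C(X, ℂ) →⋆ₐ[ℂ] B
  u : B
  mem_unitary : u ∈ unitary B
  covariant : ∀ f : C(X, ℂ), u * π f * star u = π (f.comp (φ.symm : C(X, X)))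

attribute [instance] CovariantRep.cstar CovariantRep.nontriv

/-- The function `x ↦ exp (-i t F x)`. -/
def phase (F : C(X, ℝ)) (t : ℝ) : C(X, ℂ) where
  toFun x := Complex.exp (-(Complex.I * t * F x))
  continuous_toFun := by fun_prop

theorem phase_mul_phase (F : C(X, ℝ)) (s t : ℝ) : phase F s * phase F t = phase F (s + t) := by
  ext x
  simp only [phase, ContinuousMap.mul_apply, ContinuousMap.coe_mk, ← Complex.exp_add]
  congr 1
  push_cast
  ring

theorem phase_zero (F : C(X, ℝ)) : phase F 0 = 1 := by
  ext x
  simp [phase]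

theorem star_phase (F : C(X, ℝ)) (t : ℝ) : star (phase F t) = phase F (-t) := by
  ext x
  simp only [phase, ContinuousMap.star_apply, ContinuousMap.coe_mk]
  rw [Complex.star_def, ← Complex.exp_conj]
  simp

theorem phase_mem_unitary (F : C(X, ℝ)) (t : ℝ) : phase F t ∈ unitary C(X, ℂ) := by
  rw [Unitary.mem_iff, star_phase, phase_mul_phase, phase_mul_phase]
  simp [phase_zero]

/-- The covariant representation `(π, u π(e^{-itF}))`. -/
def CovariantRep.twist {φ : X ≃ₜ X} (ρ : CovariantRep φ) (F : C(X, ℝ)) (t : ℝ) :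
    CovariantRep φ where
  B := ρ.B
  π := ρ.π
  u := ρ.u * ρ.π (phase F t)
  mem_unitary := mul_mem ρ.mem_unitary (Unitary.map_mem ρ.π (phase_mem_unitary F t))
  covariant f := by
    have h : phase F t * f * star (phase F t) = f := by
      rw [mul_right_comm, (Unitary.mem_iff.1 (phase_mem_unitary F t)).2, one_mul]
    calc ρ.u * ρ.π (phase F t) * ρ.π f * star (ρ.u * ρ.π (phase F t))
        = ρ.u * ρ.π (phase F t * f * star (phase F t)) * star ρ.u := by
          simp only [map_mul, map_star, star_mul, mul_assoc]
      _ = _ := by rw [h, ρ.covariant]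

theorem CovariantRep.twist_twist {φ : X ≃ₜ X} (ρ : CovariantRep φ) (F : C(X, ℝ)) (s t : ℝ) :
    (ρ.twist F s).twist F t = ρ.twist F (s + t) := by
  have h : ρ.u * ρ.π (phase F s) * ρ.π (phase F t) = ρ.u * ρ.π (phase F (s + t)) := by
    rw [mul_assoc, ← map_mul, phase_mul_phase]
  have key : ∀ (v w : ρ.B) (hv : v ∈ unitary ρ.B) (hw : w ∈ unitary ρ.B)
      (cv : ∀ f : C(X, ℂ), v * ρ.π f * star v = ρ.π (f.comp (φ.symm : C(X, X))))
      (cw : ∀ f : C(X, ℂ), w * ρ.π f * star w = ρ.π (f.comp (φ.symm : C(X, X)))), v = w →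
      (⟨ρ.B, ρ.π, v, hv, cv⟩ : CovariantRep φ) = ⟨ρ.B, ρ.π, w, hw, cw⟩ := by
    rintro v _ hv _ cv _ rfl
    rfl
  exact key _ _ _ _ _ _ h

theorem CovariantRep.twist_zero {φ : X ≃ₜ X} (ρ : CovariantRep φ) (F : C(X, ℝ)) :
    ρ.twist F 0 = ρ := by
  cases ρ
  simp [twist, phase_zero]

/-- The `ℓ^∞`-product of the target algebras of all covariant representations of `(X, φ)`. -/
abbrev CovariantProduct (φ : X ≃ₜ X) : Type (u + 1) :=
  lp (fun ρ : CovariantRep φ => ρ.B) ∞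

instance (φ : X ≃ₜ X) : CStarAlgebra (CovariantProduct φ) where

variable [CompactSpace X]

/-- The product of all the `*`-homomorphisms `π`. -/
def productFunction (φ : X ≃ₜ X) : C(X, ℂ) →⋆ₐ[ℂ] CovariantProduct φ where
  toFun f := ⟨fun ρ => ρ.π f, memℓp_infty ⟨‖f‖, by
    rintro _ ⟨ρ, rfl⟩
    exact NonUnitalStarAlgHom.norm_apply_le ρ.π f⟩⟩
  map_one' := by ext ρ; exact map_one ρ.π
  map_mul' f g := by ext ρ; exact map_mul ρ.π f g
  map_zero' := by ext ρ; exact map_zero ρ.π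
  map_add' f g := by ext ρ; exact map_add ρ.π f g
  commutes' c := by ext ρ; exact AlgHomClass.commutes ρ.π c
  map_star' f := by ext ρ; exact map_star ρ.π f

/-- The product of all the unitaries `u`. -/
def productUnitary (φ : X ≃ₜ X) : CovariantProduct φ :=
  ⟨fun ρ => ρ.u, memℓp_infty ⟨1, by
    rintro _ ⟨ρ, rfl⟩
    exact (CStarRing.norm_of_mem_unitary ρ.mem_unitary).le⟩⟩

/-- The `*`-algebra generated by `C(X)` and `U`. -/
def productAdjoin (φ : X ≃ₜ X) : StarSubalgebra ℂ (CovariantProduct φ) :=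
  StarAlgebra.adjoin ℂ (insert (productUnitary φ) (Set.range (productFunction φ)))

/-- The crossed product `C(X) ⋊_φ ℤ`: the universal C*-algebra generated by a copy of `C(X)` and a
unitary `U` with `U f U* = f ∘ φ⁻¹`. It is built as the C*-algebra generated by `C(X)` and `U` in
the product of all covariant representations, that is, as the completion in the largest C*-norm;
its universal property is `CrossedProduct.existsUnique_lift`. -/
abbrev CrossedProduct (φ : X ≃ₜ X) : Type (u + 1) :=
  (productAdjoin φ).topologicalClosure

instance (φ : X ≃ₜ X) : CStarAlgebra (CrossedProduct φ) :=
  StarSubalgebra.cstarAlgebra _ (h_closed := (productAdjoin φ).isClosed_topologicalClosure)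

namespace CrossedProduct

theorem function_mem (φ : X ≃ₜ X) (f : C(X, ℂ)) :
    productFunction φ f ∈ (productAdjoin φ).topologicalClosure :=
  (productAdjoin φ).le_topologicalClosure
    (StarAlgebra.subset_adjoin ℂ _ (Set.mem_insert_of_mem _ ⟨f, rfl⟩))

theorem unitary_mem (φ : X ≃ₜ X) : productUnitary φ ∈ (productAdjoin φ).topologicalClosure :=
  (productAdjoin φ).le_topologicalClosure
    (StarAlgebra.subset_adjoin ℂ _ (Set.mem_insert _ _))

/-- The canonical copy of `C(X)` in the crossed product. -/
def ofFunction (φ : X ≃ₜ X) : C(X, ℂ) →⋆ₐ[ℂ] CrossedProduct φ :=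
  (productFunction φ).codRestrict _ (function_mem φ)

/-- The canonical unitary `U`. -/
def U (φ : X ≃ₜ X) : CrossedProduct φ := ⟨productUnitary φ, unitary_mem φ⟩

theorem U_mem_unitary (φ : X ≃ₜ X) : U φ ∈ unitary (CrossedProduct φ) := by
  constructor
  · ext ρ; exact (Unitary.mem_iff.1 ρ.mem_unitary).1
  · ext ρ; exact (Unitary.mem_iff.1 ρ.mem_unitary).2

theorem U_covariant (φ : X ≃ₜ X) (f : C(X, ℂ)) :
    U φ * ofFunction φ f * star (U φ) = ofFunction φ (f.comp (φ.symm : C(X, X))) := by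
  ext ρ; exact ρ.covariant f

/-- Two continuous `*`-homomorphisms that agree on `C(X)` and on `U` are equal. -/
theorem hom_ext {φ : X ≃ₜ X} {C : Type*} [TopologicalSpace C] [T2Space C] [Ring C] [StarRing C]
    [Algebra ℂ C] {ψ₁ ψ₂ : CrossedProduct φ →⋆ₐ[ℂ] C} (h₁ : Continuous ψ₁) (h₂ : Continuous ψ₂)
    (hf : ∀ f, ψ₁ (ofFunction φ f) = ψ₂ (ofFunction φ f)) (hU : ψ₁ (U φ) = ψ₂ (U φ)) :
    ψ₁ = ψ₂ := by
  refine StarAlgHom.ext_topologicalClosure h₁ h₂ ?_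
  refine StarAlgHom.ext_adjoin ?_
  rintro ⟨x, hx⟩ hx'
  rcases hx' with rfl | ⟨f, rfl⟩
  · exact hU
  · exact hf f

/-- The universal property. -/
theorem existsUnique_lift {φ : X ≃ₜ X} (ρ : CovariantRep φ) :
    ∃! ψ : CrossedProduct φ →⋆ₐ[ℂ] ρ.B, (∀ f, ψ (ofFunction φ f) = ρ.π f) ∧ ψ (U φ) = ρ.u := by
  let ev : CovariantProduct φ →⋆ₐ[ℂ] ρ.B :=
    { toFun := fun x => x ρ
      map_one' := rfl
      map_mul' := fun _ _ => rfl
      map_zero' := rfl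
      map_add' := fun _ _ => rfl
      commutes' := fun _ => rfl
      map_star' := fun _ => rfl }
  refine ⟨ev.comp (StarSubalgebra.subtype _), ⟨fun f => rfl, rfl⟩, ?_⟩
  rintro ψ ⟨h₁, h₂⟩
  exact hom_ext
    (NonUnitalStarAlgHom.instContinuousLinearMapClassComplex.toContinuousMapClass.map_continuous ψ)
    (NonUnitalStarAlgHom.instContinuousLinearMapClassComplex.toContinuousMapClass.map_continuous _) h₁ h₂

end CrossedProduct

/-- Reindexing along `ρ ↦ ρ.twist F t`. -/
def productTwist (φ : X ≃ₜ X) (F : C(X, ℝ)) (t : ℝ) :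
    CovariantProduct φ →⋆ₐ[ℂ] CovariantProduct φ where
  toFun x := ⟨fun ρ => x (ρ.twist F t), memℓp_infty ⟨‖x‖, by
    rintro _ ⟨ρ, rfl⟩
    exact lp.norm_apply_le_norm ENNReal.top_ne_zero x (ρ.twist F t)⟩⟩
  map_one' := rfl
  map_mul' _ _ := rfl
  map_zero' := rfl
  map_add' _ _ := rfl
  commutes' _ := rfl
  map_star' _ := rfl

theorem productTwist_function (φ : X ≃ₜ X) (F : C(X, ℝ)) (t : ℝ) (f : C(X, ℂ)) :
    productTwist φ F t (productFunction φ f) = productFunction φ f := rfl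

theorem productTwist_unitary (φ : X ≃ₜ X) (F : C(X, ℝ)) (t : ℝ) :
    productTwist φ F t (productUnitary φ) = productUnitary φ * productFunction φ (phase F t) := rfl

theorem productTwist_mem (φ : X ≃ₜ X) (F : C(X, ℝ)) (t : ℝ) {x : CovariantProduct φ}
    (hx : x ∈ (productAdjoin φ).topologicalClosure) :
    productTwist φ F t x ∈ (productAdjoin φ).topologicalClosure := by
  have hc : Continuous (productTwist φ F t) :=
    NonUnitalStarAlgHom.instContinuousLinearMapClassComplex.toContinuousMapClass.map_continuous _
  have h : productAdjoin φ ≤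
      StarSubalgebra.comap (productTwist φ F t) (productAdjoin φ).topologicalClosure := by
    refine StarAlgebra.adjoin_le ?_
    rintro _ (rfl | ⟨f, rfl⟩)
    · exact mul_mem (CrossedProduct.unitary_mem φ) (CrossedProduct.function_mem φ _)
    · exact CrossedProduct.function_mem φ f
  exact StarSubalgebra.topologicalClosure_minimal h
    ((productAdjoin φ).isClosed_topologicalClosure.preimage hc) hx

theorem productTwist_productTwist (φ : X ≃ₜ X) (F : C(X, ℝ)) (s t : ℝ) (x : CovariantProduct φ) :
    productTwist φ F s (productTwist φ F t x) = productTwist φ F (s + t) x := by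
  ext ρ
  have key : ∀ σ : CovariantRep φ, σ = ρ.twist F (s + t) → HEq (x σ) (x (ρ.twist F (s + t))) := by
    rintro _ rfl
    rfl
  exact eq_of_heq (key _ (ρ.twist_twist F s t))

theorem productTwist_zero (φ : X ≃ₜ X) (F : C(X, ℝ)) (x : CovariantProduct φ) :
    productTwist φ F 0 x = x := by
  ext ρ
  have key : ∀ σ : CovariantRep φ, σ = ρ → HEq (x σ) (x ρ) := by
    rintro _ rfl
    rfl
  exact eq_of_heq (key _ (ρ.twist_zero F))

/-- The automorphism `α^F_t` of `C(X) ⋊_φ ℤ` with `α^F_t (f U) = f U e^{-itF}`. -/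
def crossedFlow (φ : X ≃ₜ X) (F : C(X, ℝ)) (t : ℝ) : CrossedProduct φ ≃⋆ₐ[ℂ] CrossedProduct φ where
  toFun x := ⟨productTwist φ F t x, productTwist_mem φ F t x.2⟩
  invFun x := ⟨productTwist φ F (-t) x, productTwist_mem φ F (-t) x.2⟩
  left_inv x := by
    ext1
    simp [productTwist_productTwist, productTwist_zero]
  right_inv x := by
    ext1
    simp [productTwist_productTwist, productTwist_zero]
  map_mul' _ _ := rfl
  map_add' _ _ := rfl
  map_star' _ := rfl
  map_smul' c x := by
    ext1
    exact map_smul (productTwist φ F t) c (x : CovariantProduct φ)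

theorem crossedFlow_ofFunction_mul_U (φ : X ≃ₜ X) (F : C(X, ℝ)) (t : ℝ) (f : C(X, ℂ)) :
    crossedFlow φ F t (CrossedProduct.ofFunction φ f * CrossedProduct.U φ) =
      CrossedProduct.ofFunction φ f * CrossedProduct.U φ *
        CrossedProduct.ofFunction φ (phase F t) := by
  rw [mul_assoc]
  rfl

theorem crossedFlow_add (φ : X ≃ₜ X) (F : C(X, ℝ)) (s t : ℝ) (x : CrossedProduct φ) :
    crossedFlow φ F (s + t) x = crossedFlow φ F s (crossedFlow φ F t x) :=
  Subtype.ext (productTwist_productTwist φ F s t x).symm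

end CrossedProduct

section KMS

variable {A : Type*} [CStarAlgebra A]

/-- `f` is the entire extension `z ↦ α_z(a)` of the orbit map `t ↦ α_t(a)`; `a` is an (entire)
analytic element for `α` when such an `f` exists, and then `f` is unique. -/
def IsEntireExtension (α : ℝ → A ≃⋆ₐ[ℂ] A) (a : A) (f : ℂ → A) : Prop :=
  Differentiable ℂ f ∧ ∀ t : ℝ, f t = α t a

/-- `ω` is a `β`-KMS state for the flow `α`: it is a state, and `ω(ab) = ω(b α_{iβ}(a))` for all
`a`, `b` in some dense `α`-invariant `*`-algebra of `α`-analytic elements. -/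
structure IsKMSState (α : ℝ → A ≃⋆ₐ[ℂ] A) (β : ℝ) (ω : A →L[ℂ] ℂ) : Prop where
  nonneg : ∀ a : A, 0 ≤ ω (star a * a)
  map_one : ω 1 = 1
  kms : ∃ D : NonUnitalStarSubalgebra ℂ A, Dense (D : Set A) ∧
    (∀ t : ℝ, ∀ a ∈ D, α t a ∈ D) ∧
    ∀ a ∈ D, ∃ f : ℂ → A, IsEntireExtension α a f ∧
      ∀ b ∈ D, ω (a * b) = ω (b * f (Complex.I * β))

end KMS

end

/-!
A `β`-KMS state restricts to a state of `C(𝕋)`, that is, to a probability measure `m`, and the KMS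
condition makes `m` conformal: `d(m ∘ φ) / dm = exp (β F)`. Iterating `n` times, the integral of
`exp (β (F + F ∘ φ + ⋯ + F ∘ φ ^ (n - 1)))` against `m` is `1` for every `n`, whereas the Birkhoff
averages of `F` converge uniformly to `∫ F ∘ h` (unique ergodicity); hence `β ∫ F ∘ h = 0`.

Existence: along an orbit of `φ`, conformality is a recurrence solved by the exponentials of `β`
times the Birkhoff sums. These sums are sublinear when `∫ F ∘ h = 0`, so damping by `exp (-s |n|)`
gives a probability vector that solves the recurrence up to a factor `exp (± s)`. Mixing the vector
states of the orbit representation with these weights gives approximate KMS states, and a weak*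
limit as `s → 0` is a KMS state.

Uniqueness: the monomials `f U ^ k` with `k ≠ 0` are killed by every KMS state because `φ` has the
eigenfunction `fourier 1 ∘ h⁻¹`, whose eigenvalue is not a root of unity. So the state is determined
by `m`, and we may rotate instead of applying `φ`. Let `|α - p / q| ≤ 1 / q ^ 2`. As in the
Denjoy–Koksma inequality, the Birkhoff sums of length at most `q` vary by a bounded amount on each
arc of radius `2 / q`, and the first `q` rotates of such an arc cover the circle with bounded
multiplicity. Comparing masses over these rotates shows that any two conformal measures are bounded
by each other up to a constant independent of `q`. Subtracting a small multiple of one from the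
other and normalising yields another conformal measure, and iterating the comparison on it forces
equality.
-/

open Filter Topology MeasureTheory Set
open scoped CStarAlgebra InnerProductSpace lp
open Complex (I ofReal)
open Complex.HadamardThreeLines (verticalClosedStrip)

section Strip

variable {E : Type*} [NormedAddCommGroup E] [NormedSpace ℂ E]

/-- An entire function that is bounded on the closed strip `0 ≤ Re z ≤ 1`. -/
structure IsEntireBoundedOnStrip (f : ℂ → E) : Prop where
  differentiable : Differentiable ℂ f
  bddAbove : BddAbove ((norm ∘ f) '' verticalClosedStrip 0 1)

namespace IsEntireBoundedOnStrip

variable {f g : ℂ → E}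

theorem sub (hf : IsEntireBoundedOnStrip f) (hg : IsEntireBoundedOnStrip g) :
    IsEntireBoundedOnStrip (f - g) := by
  obtain ⟨A, hA⟩ := hf.bddAbove
  obtain ⟨B, hB⟩ := hg.bddAbove
  refine ⟨hf.differentiable.sub hg.differentiable, A + B, ?_⟩
  rintro _ ⟨z, hz, rfl⟩
  exact (norm_sub_le _ _).trans (add_le_add (hA ⟨z, hz, rfl⟩) (hB ⟨z, hz, rfl⟩))

theorem norm_ofReal_le (hf : IsEntireBoundedOnStrip f) {A B : ℝ}
    (hA : ∀ z : ℂ, z.re = 0 → ‖f z‖ ≤ A) (hB : ∀ z : ℂ, z.re = 1 → ‖f z‖ ≤ B) {s : ℝ}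
    (hs : s ∈ Icc (0 : ℝ) 1) : ‖f s‖ ≤ A ^ (1 - s) * B ^ s := by
  simpa using Complex.HadamardThreeLines.norm_le_interp_of_mem_verticalClosedStrip' (z := (s : ℂ))
    zero_lt_one hs hf.differentiable.diffContOnCl hf.bddAbove hA hB

theorem norm_ofReal_le_of_edges (hf : IsEntireBoundedOnStrip f) {A : ℝ} (hA : 0 < A)
    (h₀ : ∀ z : ℂ, z.re = 0 → ‖f z‖ ≤ A) (h₁ : ∀ z : ℂ, z.re = 1 → ‖f z‖ ≤ A) {s : ℝ}
    (hs : s ∈ Icc (0 : ℝ) 1) : ‖f s‖ ≤ A := by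
  have h := hf.norm_ofReal_le h₀ h₁ hs
  rwa [← Real.rpow_add hA, sub_add_cancel, Real.rpow_one] at h

variable {G : ℕ → ℂ → E} {K : ℂ → E}

theorem exists_forall_norm_sub_le (hG : ∀ n, IsEntireBoundedOnStrip (G n))
    (hK : IsEntireBoundedOnStrip K) (hcau : UniformCauchySeqOn G atTop {z : ℂ | z.re = 1}) :
    ∃ B, ∀ᶠ n in atTop, ∀ z : ℂ, z.re = 1 → ‖(G n - K) z‖ ≤ B := by
  obtain ⟨N, hN⟩ := Metric.uniformCauchySeqOn_iff.1 hcau 1 one_pos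
  obtain ⟨B, hB⟩ := ((hG N).sub hK).bddAbove
  refine ⟨1 + B, (eventually_ge_atTop N).mono fun n hn z hz => ?_⟩
  have hnear : ‖G n z - G N z‖ ≤ 1 := by
    simpa [dist_eq_norm] using (hN n hn N le_rfl z hz).le
  have hbase : ‖G N z - K z‖ ≤ B := hB ⟨z, by simp [verticalClosedStrip, hz], rfl⟩
  calc ‖G n z - K z‖ = ‖(G n z - G N z) + (G N z - K z)‖ := by rw [sub_add_sub_cancel]
    _ ≤ 1 + B := norm_add_le_of_le hnear hbase

theorem tendsto_ofReal (hG : ∀ n, IsEntireBoundedOnStrip (G n))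
    (hK : IsEntireBoundedOnStrip K) (hlim : TendstoUniformlyOn G K atTop {z : ℂ | z.re = 0})
    (hcau : UniformCauchySeqOn G atTop {z : ℂ | z.re = 1}) {s : ℝ} (hs : s ∈ Ico (0 : ℝ) 1) :
    Tendsto (fun n => G n s) atTop (𝓝 (K s)) := by
  obtain ⟨B, hB⟩ := exists_forall_norm_sub_le hG hK hcau
  have hinterp : Tendsto (fun η : ℝ => η ^ (1 - s) * B ^ s) (𝓝[>] 0) (𝓝 0) := by
    have h := (Real.continuousAt_rpow_const 0 (1 - s) (.inr (by linarith [hs.2]))).tendsto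
    rw [Real.zero_rpow (by linarith [hs.2])] at h
    simpa using (h.mono_left nhdsWithin_le_nhds).mul_const (B ^ s)
  rw [Metric.tendsto_nhds]
  intro ε hε
  obtain ⟨η, hηε, hη⟩ :=
    ((hinterp.eventually (gt_mem_nhds hε)).and self_mem_nhdsWithin).exists
  filter_upwards [hB, Metric.tendstoUniformlyOn_iff.1 hlim η hη] with n hright hleft
  rw [dist_eq_norm]
  refine (((hG n).sub hK).norm_ofReal_le (fun z hz => ?_) hright
    (Ico_subset_Icc_self hs)).trans_lt hηε
  simpa [dist_eq_norm, norm_sub_rev] using (hleft z hz).le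

/-- By the three lines theorem, `G n → K` on the open strip; uniform Cauchyness of `G n` carries
the convergence over to the right edge. -/
theorem tendsto_one (hG : ∀ n, IsEntireBoundedOnStrip (G n)) (hK : IsEntireBoundedOnStrip K)
    (hlim : TendstoUniformlyOn G K atTop {z : ℂ | z.re = 0})
    (hcau : UniformCauchySeqOn G atTop {z : ℂ | z.re = 1}) :
    Tendsto (fun n => G n 1) atTop (𝓝 (K 1)) := by
  rw [Metric.tendsto_atTop]
  intro ε hε
  obtain ⟨N₀, hN₀⟩ := Metric.uniformCauchySeqOn_iff.1 hlim.uniformCauchySeqOn (ε / 2) (half_pos hε)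
  obtain ⟨N₁, hN₁⟩ := Metric.uniformCauchySeqOn_iff.1 hcau (ε / 2) (half_pos hε)
  refine ⟨max N₀ N₁, fun m hm => ?_⟩
  have hinner : ∀ s ∈ Ico (0 : ℝ) 1, ‖G m s - K s‖ ≤ ε / 2 := fun s hs => by
    refine le_of_tendsto ((tendsto_ofReal hG hK hlim hcau hs).const_sub (G m s)).norm
      ((eventually_ge_atTop (max N₀ N₁)).mono fun n hn => ?_)
    refine ((hG m).sub (hG n)).norm_ofReal_le_of_edges (half_pos hε) (fun z hz => ?_)
      (fun z hz => ?_) (Ico_subset_Icc_self hs)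
    · simpa [dist_eq_norm] using
        (hN₀ m (le_of_max_le_left hm) n (le_of_max_le_left hn) z hz).le
    · simpa [dist_eq_norm] using
        (hN₁ m (le_of_max_le_right hm) n (le_of_max_le_right hn) z hz).le
  have hcont : Continuous fun s : ℝ => ‖G m s - K s‖ :=
    (((hG m).differentiable.sub hK.differentiable).continuous.comp
      Complex.continuous_ofReal).norm
  have hone : ‖G m (1 : ℝ) - K (1 : ℝ)‖ ≤ ε / 2 :=
    le_of_tendsto (hcont.tendsto 1 |>.mono_left (nhdsWithin_le_nhds (s := Iio 1)))
      (by filter_upwards [Ico_mem_nhdsLT zero_lt_one] with s hs using hinner s hs)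
  rw [Complex.ofReal_one] at hone
  rw [dist_eq_norm]
  linarith

end IsEntireBoundedOnStrip

end Strip

section KMSCondition

theorem eq_of_forall_ofReal_eq {E : Type*} [NormedAddCommGroup E] [NormedSpace ℂ E]
    [CompleteSpace E] {f g : ℂ → E} (hf : Differentiable ℂ f) (hg : Differentiable ℂ g)
    (h : ∀ t : ℝ, f t = g t) : f = g := by
  refine AnalyticOnNhd.eq_of_frequently_eq (z₀ := 0)
    (fun z _ => hf.analyticAt z) (fun z _ => hg.analyticAt z) ?_
  have hofReal : Tendsto ofReal (𝓝[≠] 0) (𝓝[≠] 0) :=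
    tendsto_nhdsWithin_of_tendsto_nhds_of_eventually_within _
      ((Complex.continuous_ofReal.tendsto' 0 0 Complex.ofReal_zero).mono_left nhdsWithin_le_nhds)
      (eventually_nhdsWithin_of_forall fun t ht => Complex.ofReal_ne_zero.2 ht)
  exact hofReal.frequently (Frequently.of_forall h)

variable {A : Type*} [CStarAlgebra A] {α : ℝ → A ≃⋆ₐ[ℂ] A}

namespace IsEntireExtension

variable {a : A} {f : ℂ → A}

theorem apply_add (hα : ∀ s t a, α (s + t) a = α s (α t a)) (hf : IsEntireExtension α a f)
    (t : ℝ) (z : ℂ) : f (t + z) = α t (f z) := by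
  let L : A →L[ℂ] A :=
    ⟨(α t : A →⋆ₐ[ℂ] A).toAlgHom.toLinearMap, map_continuous (α t)⟩
  have hL : Differentiable ℂ fun z => α t (f z) := L.differentiable.comp hf.1
  refine congrFun (eq_of_forall_ofReal_eq (f := fun z => f (t + z)) (g := fun z => α t (f z))
    (hf.1.comp (differentiable_id.const_add _)) hL fun s => ?_) z
  rw [← Complex.ofReal_add, hf.2, hf.2, hα]

theorem translate (hα : ∀ s t a, α (s + t) a = α s (α t a)) (hf : IsEntireExtension α a f)
    (t : ℝ) : IsEntireExtension α (α t a) fun z => f (t + z) := by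
  refine ⟨hf.1.comp (differentiable_id.const_add _), fun s => ?_⟩
  beta_reduce
  rw [← Complex.ofReal_add, hf.2, add_comm, hα]

theorem unique {g : ℂ → A} (hf : IsEntireExtension α a f) (hg : IsEntireExtension α a g) : f = g :=
  eq_of_forall_ofReal_eq hf.1 hg.1 fun t => by rw [hf.2, hg.2]

theorem exists_norm_le (hα : ∀ s t a, α (s + t) a = α s (α t a)) (hf : IsEntireExtension α a f)
    (β : ℝ) : ∃ B, ∀ z ∈ verticalClosedStrip 0 1, ‖f (I * β * z)‖ ≤ B := by
  have hc := hf.1.continuous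
  obtain ⟨B, hB⟩ := (isCompact_Icc (a := (0 : ℝ)) (b := 1)).exists_bound_of_continuousOn
    (f := fun s : ℝ => f (I * β * s)) (by fun_prop)
  refine ⟨B, fun z hz => ?_⟩
  have hz' : I * β * z = ((-(β * z.im) : ℝ) : ℂ) + I * β * (z.re : ℂ) := by
    apply Complex.ext <;> simp
  rw [hz', hf.apply_add hα, StarAlgEquiv.norm_map]
  exact hB z.re hz

end IsEntireExtension

/-- The function `z ↦ ω (b f(iβz))`, where `f` extends the orbit of `a`. It takes the values
`ω (b α_t(a))` on the edge `Re z = 0` of the strip `0 ≤ Re z ≤ 1` and, under the `β`-KMS condition,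
the values `ω (α_t(a) b)` on the edge `Re z = 1`. -/
noncomputable def kmsFunction (ω : A →L[ℂ] ℂ) (β : ℝ) (b : A) (f : ℂ → A) (z : ℂ) : ℂ :=
  ω (b * f (I * β * z))

section KMSFunction

variable {a b : A} {f : ℂ → A} {ω : A →L[ℂ] ℂ} {β : ℝ}

theorem isEntireBoundedOnStrip_kmsFunction (hα : ∀ s t a, α (s + t) a = α s (α t a))
    (hf : IsEntireExtension α a f) : IsEntireBoundedOnStrip (kmsFunction ω β b f) := by
  obtain ⟨B, hB⟩ := hf.exists_norm_le hα β
  refine ⟨ω.differentiable.comp ((hf.1.comp (by fun_prop)).const_mul b), ‖ω‖ * (‖b‖ * B), ?_⟩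
  rintro _ ⟨z, hz, rfl⟩
  exact ω.le_opNorm_of_le ((norm_mul_le _ _).trans (by gcongr; exact hB z hz))

theorem kmsFunction_of_re_eq_zero (hf : IsEntireExtension α a f) {z : ℂ} (hz : z.re = 0) :
    kmsFunction ω β b f z = ω (b * α (-(β * z.im)) a) := by
  have hz' : I * β * z = (-(β * z.im) : ℝ) := by apply Complex.ext <;> simp [hz]
  rw [kmsFunction, hz', hf.2]

theorem kmsFunction_of_re_eq_one (hα : ∀ s t a, α (s + t) a = α s (α t a))
    {D : NonUnitalStarSubalgebra ℂ A} (hinv : ∀ t : ℝ, ∀ a ∈ D, α t a ∈ D)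
    (hkms : ∀ a ∈ D, ∃ f : ℂ → A, IsEntireExtension α a f ∧
      ∀ b ∈ D, ω (a * b) = ω (b * f (I * β)))
    (hf : IsEntireExtension α a f) (ha : a ∈ D) (hb : b ∈ D) {z : ℂ} (hz : z.re = 1) :
    kmsFunction ω β b f z = ω (α (-(β * z.im)) a * b) := by
  obtain ⟨g, hg, hgb⟩ := hkms _ (hinv (-(β * z.im)) a ha)
  have hz' : I * β * z = (-(β * z.im) : ℝ) + I * β := by apply Complex.ext <;> simp [hz]
  rw [hgb b hb, hg.unique (hf.translate hα _), kmsFunction, hz']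

theorem tendstoUniformlyOn_kmsFunction {c : ℕ → A} {g : ℕ → ℂ → A}
    (hf : IsEntireExtension α a f) (hg : ∀ n, IsEntireExtension α (c n) (g n))
    (hca : Tendsto c atTop (𝓝 a)) :
    TendstoUniformlyOn (fun n => kmsFunction ω β b (g n)) (kmsFunction ω β b f) atTop
      {z | z.re = 0} := by
  rw [Metric.tendstoUniformlyOn_iff]
  intro ε hε
  have hsmall : Tendsto (fun n => ‖ω‖ * (‖b‖ * ‖a - c n‖)) atTop (𝓝 0) := by
    simpa using ((hca.const_sub a).norm.const_mul ‖b‖).const_mul ‖ω‖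
  filter_upwards [hsmall.eventually (gt_mem_nhds hε)] with n hn z hz
  rw [kmsFunction_of_re_eq_zero hf hz, kmsFunction_of_re_eq_zero (hg n) hz, dist_eq_norm,
    ← map_sub, ← mul_sub, ← map_sub]
  refine (ω.le_opNorm_of_le ((norm_mul_le _ _).trans_eq ?_)).trans_lt hn
  rw [StarAlgEquiv.norm_map]

theorem uniformCauchySeqOn_kmsFunction {c : ℕ → A} {g : ℕ → ℂ → A} (hc : CauchySeq c)
    (hright : ∀ n z, z.re = 1 → kmsFunction ω β b (g n) z = ω (α (-(β * z.im)) (c n) * b)) :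
    UniformCauchySeqOn (fun n => kmsFunction ω β b (g n)) atTop {z | z.re = 1} := by
  rw [Metric.uniformCauchySeqOn_iff]
  intro ε hε
  obtain ⟨N, hN⟩ := Metric.cauchySeq_iff.1 hc (ε / (‖ω‖ * ‖b‖ + 1)) (by positivity)
  refine ⟨N, fun m hm n hn z hz => ?_⟩
  have hmn := hN m hm n hn
  rw [dist_eq_norm, lt_div_iff₀ (by positivity)] at hmn
  rw [hright m z hz, hright n z hz, dist_eq_norm, ← map_sub, ← sub_mul, ← map_sub]
  refine (ω.le_opNorm_of_le (norm_mul_le _ _)).trans_lt ?_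
  rw [StarAlgEquiv.norm_map]
  nlinarith [norm_nonneg (c m - c n)]

end KMSFunction

/-- The KMS condition, required on some dense `*`-algebra of analytic elements, holds for all
analytic elements: approximate `a` by `c n ∈ D`; the KMS functions of the `c n` converge to the one
of `a` on the left edge of the strip and are uniformly Cauchy on the right edge. -/
theorem IsKMSState.apply_mul_eq (hα : ∀ s t a, α (s + t) a = α s (α t a)) {β : ℝ}
    {ω : A →L[ℂ] ℂ} (hω : IsKMSState α β ω) {a : A} {f : ℂ → A} (hf : IsEntireExtension α a f)
    (b : A) : ω (a * b) = ω (b * f (I * β)) := by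
  obtain ⟨D, hD, hinv, hkms⟩ := hω.kms
  revert b
  suffices H : ∀ b ∈ D, ω (a * b) = ω (b * f (I * β)) from
    congrFun (Continuous.ext_on hD (by fun_prop) (by fun_prop) H)
  intro b hb
  obtain ⟨c, hcD, hca⟩ := mem_closure_iff_seq_limit.1 (hD a)
  choose g hg using fun n => hkms (c n) (hcD n)
  have hone := IsEntireBoundedOnStrip.tendsto_one
    (fun n => isEntireBoundedOnStrip_kmsFunction (ω := ω) (β := β) (b := b) hα (hg n).1)
    (isEntireBoundedOnStrip_kmsFunction hα hf)
    (tendstoUniformlyOn_kmsFunction hf (fun n => (hg n).1) hca)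
    (uniformCauchySeqOn_kmsFunction hca.cauchySeq fun n z hz =>
      kmsFunction_of_re_eq_one hα hinv hkms (hg n).1 (hcD n) hb hz)
  have hleft : Tendsto (fun n => ω (c n * b)) atTop (𝓝 (ω (a * b))) :=
    (ω.continuous.tendsto _).comp (hca.mul_const b)
  refine tendsto_nhds_unique hleft ?_
  simpa only [kmsFunction, mul_one, ← (hg _).2 b hb] using hone

end KMSCondition

section Koopman

variable {X 𝕜 : Type*} [TopologicalSpace X] [RCLike 𝕜]

/-- The Koopman operator `g ↦ g ∘ T` of a continuous map `T`. -/
def koopman (𝕜 : Type*) [RCLike 𝕜] (T : C(X, X)) : C(X, 𝕜) →ₗ[𝕜] C(X, 𝕜) :=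
  (ContinuousMap.compRightAlgHom 𝕜 𝕜 T).toLinearMap

@[simp] theorem koopman_apply (T : C(X, X)) (g : C(X, 𝕜)) (x : X) :
    koopman 𝕜 T g x = g (T x) := rfl

theorem koopman_iterate_apply (T : C(X, X)) (n : ℕ) (g : C(X, 𝕜)) (x : X) :
    (koopman 𝕜 T)^[n] g x = g (T^[n] x) := by
  induction n generalizing g with
  | zero => rfl
  | succ n ih => rw [Function.iterate_succ_apply, ih, koopman_apply, Function.iterate_succ_apply']

theorem birkhoffSum_koopman_apply (T : C(X, X)) (n : ℕ) (g : C(X, 𝕜)) (x : X) :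
    birkhoffSum (koopman 𝕜 T) id n g x = birkhoffSum T g n x := by
  simp only [birkhoffSum, ContinuousMap.sum_apply, id, koopman_iterate_apply]

theorem lipschitzWith_koopman [CompactSpace X] (T : C(X, X)) : LipschitzWith 1 (koopman 𝕜 T) :=
  LipschitzWith.of_dist_le_mul fun f g => by
    rw [NNReal.coe_one, one_mul, ContinuousMap.dist_le dist_nonneg]
    exact fun x => ContinuousMap.dist_apply_le_dist (T x)

end Koopman

section Equidistribution

theorem tendsto_birkhoffAverage_of_apply_eq_smul {𝕜 E : Type*} [RCLike 𝕜] [NormedAddCommGroup E]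
    [NormedSpace 𝕜 E] {f : E →ₗ[𝕜] E} (hf : LipschitzWith 1 f) {c : 𝕜} (hc : c ≠ 1) {x : E}
    (hx : f x = c • x) : Tendsto (birkhoffAverage 𝕜 f id · x) atTop (𝓝 0) := by
  have hbdd : Bornology.IsBounded (range fun n => id (f^[n] x)) :=
    isBounded_iff_forall_norm_le.2 ⟨‖x‖, forall_mem_range.2 fun n => by
      simpa [iterate_map_zero] using (hf.iterate n).dist_le_mul x 0⟩
  have hdiff := tendsto_birkhoffAverage_apply_sub_birkhoffAverage 𝕜 hbdd
  have hsmul : ∀ n, birkhoffAverage 𝕜 f id n (f x) - birkhoffAverage 𝕜 f id n x =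
      (c - 1) • birkhoffAverage 𝕜 f id n x := fun n => by
    simp only [birkhoffAverage, birkhoffSum, id, hx, ← Module.End.pow_apply, map_smul,
      ← Finset.smul_sum, sub_smul, one_smul, smul_comm c]
  simp only [hsmul] at hdiff
  simpa [smul_smul, sub_ne_zero.2 hc] using hdiff.const_smul (c - 1)⁻¹

theorem integrable_continuousMap {X E : Type*} [TopologicalSpace X] [CompactSpace X]
    [MeasurableSpace X] [OpensMeasurableSpace X] [NormedAddCommGroup E] {μ : Measure X}
    [IsFiniteMeasure μ] (G : C(X, E)) : Integrable G μ :=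
  G.continuous.integrable_of_hasCompactSupport (HasCompactSupport.of_compactSpace _)

/-- The rotation `x ↦ x + α` of the circle. -/
def circleRotation (α : UnitAddCircle) : UnitAddCircle ≃ₜ UnitAddCircle := Homeomorph.addRight α

@[simp] theorem circleRotation_apply (α x : UnitAddCircle) : circleRotation α x = x + α := rfl

theorem fourier_coe_ne_one {α : ℝ} (hα : Irrational α) {k : ℤ} (hk : k ≠ 0) :
    (fourier k (α : UnitAddCircle) : ℂ) ≠ 1 := by
  rw [fourier_coe_apply]
  intro h
  obtain ⟨m, hm⟩ := Complex.exp_eq_one_iff.1 h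
  have hkα : (k : ℂ) * α = m := by
    apply mul_left_cancel₀ Complex.two_pi_I_ne_zero
    rw [mul_comm _ (m : ℂ), ← hm]
    push_cast
    ring
  exact (hα.intCast_mul hk).ne_int m (by exact_mod_cast hkα)

theorem koopman_circleRotation_fourier (α : UnitAddCircle) (k : ℤ) :
    koopman ℂ (circleRotation α : C(UnitAddCircle, UnitAddCircle)) (fourier k) =
      (fourier k α : ℂ) • fourier k := by
  ext x
  simp only [koopman_apply, ContinuousMap.coe_coe, circleRotation_apply, fourier_apply, smul_add,
    AddCircle.toCircle_add, Circle.coe_mul, ContinuousMap.smul_apply, smul_eq_mul, mul_comm]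

theorem tendsto_birkhoffAverage_fourier {α : ℝ} (hα : Irrational α) (k : ℤ) :
    Tendsto (birkhoffAverage ℂ (koopman ℂ (circleRotation α : C(UnitAddCircle, UnitAddCircle))) id ·
      (fourier k)) atTop (𝓝 (.const _ (∫ x : UnitAddCircle, fourier k x))) := by
  rcases eq_or_ne k 0 with rfl | hk
  · have hfix : Function.IsFixedPt
        (koopman ℂ (circleRotation α : C(UnitAddCircle, UnitAddCircle))) (fourier 0) := by
      ext x
      simp
    convert hfix.tendsto_birkhoffAverage ℂ id
    ext x
    simp [Measure.real]
  · have hintegral : ∫ x : UnitAddCircle, (fourier k x : ℂ) = 0 := by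
      have h := congrFun (fourierCoeff_fourier (T := 1) k) 0
      simpa [fourierCoeff, hk.symm, AddCircle.volume_eq_smul_haarAddCircle] using h
    rw [hintegral]
    exact tendsto_birkhoffAverage_of_apply_eq_smul (lipschitzWith_koopman _)
      (fourier_coe_ne_one hα hk) (koopman_circleRotation_fourier α k)

theorem tendsto_birkhoffAverage_circleRotation {α : ℝ} (hα : Irrational α)
    (G : C(UnitAddCircle, ℂ)) :
    Tendsto (birkhoffAverage ℂ (koopman ℂ (circleRotation α)) id · G) atTop
      (𝓝 (.const _ (∫ x, G x))) := by
  let L : C(UnitAddCircle, ℂ) →ₗ[ℂ] C(UnitAddCircle, ℂ) :=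
    { toFun G := .const _ (∫ x, G x)
      map_add' G H := by
        ext
        exact integral_add (integrable_continuousMap G) (integrable_continuousMap H)
      map_smul' c G := by
        ext
        exact integral_const_mul c G }
  have hL : Continuous L := AddMonoidHomClass.continuous_of_bound L 1 fun G => by
    rw [one_mul]
    exact (ContinuousMap.norm_le _ (norm_nonneg G)).2 fun x => by
      simpa [L, Measure.real] using
        norm_integral_le_of_norm_le_const (μ := volume) (.of_forall G.norm_coe_le_norm)
  let S : Submodule ℂ C(UnitAddCircle, ℂ) :=
    { carrier := {G | Tendsto (birkhoffAverage ℂ (koopman ℂ (circleRotation α)) id · G) atTop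
        (𝓝 (L G))}
      add_mem' := fun {G H} hG hH => by
        simpa [birkhoffAverage, birkhoffSum, Finset.sum_add_distrib] using hG.add hH
      zero_mem' := by simp [birkhoffAverage, birkhoffSum, iterate_map_zero]
      smul_mem' := fun c G hG => by
        simpa [birkhoffAverage, birkhoffSum, ← Module.End.pow_apply, ← Finset.smul_sum,
          smul_comm c] using hG.const_smul c }
  have hS : IsClosed (S : Set C(UnitAddCircle, ℂ)) :=
    isClosed_setOfPred_tendsto_birkhoffAverage ℂ (lipschitzWith_koopman _) uniformContinuous_id hL
  have htop : (⊤ : Submodule ℂ C(UnitAddCircle, ℂ)) ≤ S := by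
    rw [← span_fourier_closure_eq_top]
    exact Submodule.topologicalClosure_minimal _
      (Submodule.span_le.2 (range_subset_iff.2 (tendsto_birkhoffAverage_fourier hα))) hS
  exact htop (Submodule.mem_top (x := G))

theorem tendsto_birkhoffAverage_circleRotation_real {α : ℝ} (hα : Irrational α)
    (W : C(UnitAddCircle, ℝ)) :
    Tendsto (birkhoffAverage ℝ (koopman ℝ (circleRotation α)) id · W) atTop
      (𝓝 (.const _ (∫ x, W x))) := by
  have h := ((ContinuousLinearMap.compLeftContinuous ℝ _ Complex.reCLM).continuous.tendsto _).comp
    (tendsto_birkhoffAverage_circleRotation hα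
      (ContinuousLinearMap.compLeftContinuous ℝ _ Complex.ofRealCLM W))
  convert h using 1
  · ext n x
    simp [birkhoffAverage, birkhoffSum, koopman_iterate_apply]
  · congr 1
    ext
    exact (congrArg Complex.re integral_complex_ofReal).symm

end Equidistribution

section Conformal

variable {X : Type*} [TopologicalSpace X]

/-- The function `x ↦ exp (W x)`. -/
noncomputable def expMap (W : C(X, ℝ)) : C(X, ℝ) := ⟨fun x => Real.exp (W x), by fun_prop⟩

@[simp] theorem expMap_apply (W : C(X, ℝ)) (x : X) : expMap W x = Real.exp (W x) := rfl

theorem expMap_add (V W : C(X, ℝ)) : expMap (V + W) = expMap V * expMap W :=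
  ContinuousMap.ext fun x => Real.exp_add (V x) (W x)

/-- `M` is integration against a probability measure `m` on `X` that is `exp W`-conformal for `φ`,
that is, `d(m ∘ φ) / dm = exp W`. -/
structure IsConformal (φ : X ≃ₜ X) (W : C(X, ℝ)) (M : C(X, ℝ) →ₗ[ℝ] ℝ) : Prop where
  nonneg : ∀ g, 0 ≤ g → 0 ≤ M g
  map_one : M 1 = 1
  map_koopman_symm : ∀ g, M (koopman ℝ φ.symm g) = M (expMap W * g)

namespace IsConformal

variable {φ : X ≃ₜ X} {W : C(X, ℝ)} {M M₁ M₂ : C(X, ℝ) →ₗ[ℝ] ℝ}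

theorem mono (hM : IsConformal φ W M) {f g : C(X, ℝ)} (h : f ≤ g) : M f ≤ M g := by
  simpa using hM.nonneg (g - f) (sub_nonneg.2 h)

theorem map_const (hM : IsConformal φ W M) (c : ℝ) : M (.const X c) = c := by
  have h : ContinuousMap.const X c = c • 1 := by
    ext
    simp
  rw [h, map_smul, hM.map_one, smul_eq_mul, mul_one]

theorem map_koopman_symm_iterate (hM : IsConformal φ W M) (n : ℕ) (g : C(X, ℝ)) :
    M ((koopman ℝ φ.symm)^[n] g) = M (expMap (birkhoffSum (koopman ℝ φ) id n W) * g) := by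
  induction n generalizing g with
  | zero =>
    congr 1
    ext x
    simp
  | succ n ih =>
    rw [Function.iterate_succ_apply, ih, add_comm, birkhoffSum_add, birkhoffSum_one, id,
      expMap_add, mul_assoc, ← hM.map_koopman_symm]
    congr 1
    ext x
    have hcomm : ∀ i, φ (φ^[i] (φ.symm x)) = φ^[i] x := fun i => by
      rw [← Function.iterate_succ_apply' φ, Function.iterate_succ_apply, φ.apply_symm_apply]
    simp [birkhoffSum, ContinuousMap.sum_apply, koopman_iterate_apply, hcomm]

theorem map_expMap_birkhoffSum (hM : IsConformal φ W M) (n : ℕ) :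
    M (expMap (birkhoffSum (koopman ℝ φ) id n W)) = 1 := by
  have hone : (koopman ℝ φ.symm)^[n] (1 : C(X, ℝ)) = 1 := by
    ext x
    simp [koopman_iterate_apply]
  rw [← mul_one (expMap _), ← hM.map_koopman_symm_iterate, hone, hM.map_one]

theorem abs_le_norm_birkhoffAverage_sub [CompactSpace X] (hM : IsConformal φ W M) (c : ℝ) {n : ℕ}
    (hn : 0 < n) : |c| ≤ ‖birkhoffAverage ℝ (koopman ℝ φ) id n W - .const X c‖ := by
  set d := ‖birkhoffAverage ℝ (koopman ℝ φ) id n W - .const X c‖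
  have hn' : (0 : ℝ) < n := Nat.cast_pos.2 hn
  have hclose : ∀ x, |birkhoffSum (koopman ℝ φ) id n W x / n - c| ≤ d := fun x => by
    simpa [d, birkhoffAverage, div_eq_inv_mul] using
      (birkhoffAverage ℝ (koopman ℝ φ) id n W - .const X c).norm_coe_le_norm x
  have hupper : M (expMap (birkhoffSum (koopman ℝ φ) id n W)) ≤ Real.exp (n * (c + d)) := by
    rw [← hM.map_const (Real.exp _)]
    refine hM.mono fun x => Real.exp_le_exp.2 ?_
    rw [← div_le_iff₀' hn']
    linarith [(abs_le.1 (hclose x)).2]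
  have hlower : Real.exp (n * (c - d)) ≤ M (expMap (birkhoffSum (koopman ℝ φ) id n W)) := by
    rw [← hM.map_const (Real.exp _)]
    refine hM.mono fun x => Real.exp_le_exp.2 ?_
    rw [← le_div_iff₀' hn']
    linarith [(abs_le.1 (hclose x)).1]
  rw [hM.map_expMap_birkhoffSum] at hupper hlower
  have hneg : -d ≤ c := by
    linarith [nonneg_of_mul_nonneg_right (Real.one_le_exp_iff.1 hupper) hn']
  have hpos : c ≤ d := by
    linarith [nonpos_of_mul_nonpos_right (Real.exp_le_one_iff.1 hlower) hn']
  exact abs_le.2 ⟨hneg, hpos⟩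

theorem eq_zero_of_tendsto_birkhoffAverage [CompactSpace X] (hM : IsConformal φ W M) {c : ℝ}
    (h : Tendsto (birkhoffAverage ℝ (koopman ℝ φ) id · W) atTop (𝓝 (.const X c))) : c = 0 := by
  refine abs_nonpos_iff.1 (ge_of_tendsto (tendsto_iff_norm_sub_tendsto_zero.1 h) ?_)
  exact (eventually_gt_atTop 0).mono fun n hn => hM.abs_le_norm_birkhoffAverage_sub c hn

theorem of_conj {h ψ : X ≃ₜ X} (hM : IsConformal ((h.symm.trans ψ).trans h) W M) :
    IsConformal ψ (koopman ℝ h W) (M ∘ₗ koopman ℝ h.symm) where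
  nonneg g hg := hM.nonneg _ fun x => hg (h.symm x)
  map_one := hM.map_one
  map_koopman_symm g := by
    have h₁ : koopman ℝ h.symm (koopman ℝ ψ.symm g) =
        koopman ℝ ((h.symm.trans ψ).trans h).symm (koopman ℝ h.symm g) := by
      ext x
      simp
    have h₂ : koopman ℝ h.symm (expMap (koopman ℝ h W) * g) = expMap W * koopman ℝ h.symm g := by
      ext x
      simp
    rw [LinearMap.comp_apply, LinearMap.comp_apply, h₁, h₂, hM.map_koopman_symm]

theorem sub_smul (h₁ : IsConformal φ W M₁) (h₂ : IsConformal φ W M₂) {c : ℝ} (hc : c < 1)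
    (h : ∀ g, 0 ≤ g → c * M₁ g ≤ M₂ g) : IsConformal φ W ((1 - c)⁻¹ • (M₂ - c • M₁)) where
  nonneg g hg := mul_nonneg (inv_nonneg.2 (sub_nonneg.2 hc.le)) (sub_nonneg.2 (h g hg))
  map_one := by
    simp [h₁.map_one, h₂.map_one, inv_mul_cancel₀ (sub_pos.2 hc).ne']
  map_koopman_symm g := by
    simp [h₁.map_koopman_symm, h₂.map_koopman_symm]

theorem eq_of_forall_nonneg_le [CompactSpace X] (h₁ : IsConformal φ W M₁)
    (h₂ : IsConformal φ W M₂) (h : ∀ g, 0 ≤ g → M₁ g ≤ M₂ g) : M₁ = M₂ := by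
  have hle : ∀ g, M₁ g ≤ M₂ g := fun g => by
    have hg : 0 ≤ g + .const X ‖g‖ := fun x => by
      simpa using neg_le_iff_add_nonneg.1 (neg_le_of_abs_le (g.norm_coe_le_norm x))
    simpa [h₁.map_const, h₂.map_const] using h _ hg
  ext g
  exact le_antisymm (hle g) (by simpa using hle (-g))

/-- If `c M₁ ≤ M₂` for all conformal `M₁` and `M₂`, apply this to `M₁` and the conformal functional
`(M₂ - c M₁) / (1 - c)` and iterate: `(1 - (1 - c) ^ n) M₁ ≤ M₂` for all `n`. -/
theorem eq_of_comparable [CompactSpace X] {c : ℝ} (hc₀ : 0 < c) (hc₁ : c < 1)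
    (hcomp : ∀ {M₁ M₂ : C(X, ℝ) →ₗ[ℝ] ℝ}, IsConformal φ W M₁ → IsConformal φ W M₂ →
      ∀ g, 0 ≤ g → c * M₁ g ≤ M₂ g)
    (h₁ : IsConformal φ W M₁) (h₂ : IsConformal φ W M₂) : M₁ = M₂ := by
  have hpow : ∀ n : ℕ, ∀ {M₂ : C(X, ℝ) →ₗ[ℝ] ℝ}, IsConformal φ W M₂ → ∀ g, 0 ≤ g →
      (1 - (1 - c) ^ n) * M₁ g ≤ M₂ g := by
    intro n
    induction n with
    | zero => intro M₂ h₂ g hg; simpa using h₂.nonneg g hg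
    | succ n ih =>
      intro M₂ h₂ g hg
      have hstep := ih (h₁.sub_smul h₂ hc₁ (hcomp h₁ h₂)) g hg
      simp only [LinearMap.smul_apply, LinearMap.sub_apply, smul_eq_mul] at hstep
      rw [le_inv_mul_iff₀ (sub_pos.2 hc₁)] at hstep
      linear_combination hstep
  refine h₁.eq_of_forall_nonneg_le h₂ fun g hg => ?_
  have hlim := ((tendsto_pow_atTop_nhds_zero_of_lt_one (sub_nonneg.2 hc₁.le)
    (sub_lt_self 1 hc₀)).const_sub 1).mul_const (M₁ g)
  rw [sub_zero, one_mul] at hlim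
  exact le_of_tendsto' hlim fun n => hpow n h₂ g hg

end IsConformal

end Conformal

section Variation

variable {X : Type*} [TopologicalSpace X] [MeasurableSpace X]

/-- The oscillation of `W` over a connected set is at most the `μ`-measure of that set. On the
circle this is bounded variation in a form that can be transported by homeomorphisms. -/
def DominatesVariation (μ : Measure X) (W : C(X, ℝ)) : Prop :=
  ∀ A, IsPreconnected A → ∀ x ∈ A, ∀ y ∈ A, |W y - W x| ≤ μ.real A

namespace DominatesVariation

variable {μ : Measure X} {W : C(X, ℝ)}

theorem smul (hW : DominatesVariation μ W) (β : ℝ) : DominatesVariation (‖β‖₊ • μ) (β • W) := by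
  intro A hA x hx y hy
  calc |(β • W) y - (β • W) x| = |β| * |W y - W x| := by
        simp [← mul_sub, abs_mul]
    _ ≤ |β| * μ.real A := by gcongr; exact hW A hA x hx y hy
    _ = (‖β‖₊ • μ).real A := by simp [measureReal_nnreal_smul_apply]

theorem koopman [BorelSpace X] (hW : DominatesVariation μ W) (h : X ≃ₜ X) :
    DominatesVariation (μ.map h.symm) (koopman ℝ h W) := by
  intro A hA x hx y hy
  have hmap : (μ.map h.symm).real A = μ.real (h '' A) := by
    rw [measureReal_def, h.image_eq_preimage_symm]
    exact congrArg ENNReal.toReal (h.symm.toMeasurableEquiv.map_apply A)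
  rw [hmap]
  exact hW _ (hA.image h h.continuous.continuousOn) _ (mem_image_of_mem h hx) _
    (mem_image_of_mem h hy)

end DominatesVariation

theorem exists_measure_dominating_of_boundedVariationOn {f : ℝ → ℝ} (hf : Continuous f)
    (hbv : BoundedVariationOn f univ) :
    ∃ ν : Measure ℝ, IsFiniteMeasure ν ∧ ∀ s t, s ≤ t → |f t - f s| ≤ ν.real (Icc s t) := by
  refine ⟨SignedMeasure.totalVariation hbv.vectorMeasure, inferInstance, fun s t hst => ?_⟩
  have h := SignedMeasure.norm_le_totalVariation hbv.vectorMeasure (Icc s t)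
  rwa [hbv.vectorMeasure_Icc hst, hf.continuousAt.continuousWithinAt.rightLim_eq,
    hf.continuousAt.continuousWithinAt.leftLim_eq] at h

theorem exists_measure_dominating_on_Icc {f : ℝ → ℝ} {a b : ℝ} (hab : a ≤ b) (hf : Continuous f)
    (hbv : BoundedVariationOn f (Icc a b)) :
    ∃ ν : Measure ℝ, IsFiniteMeasure ν ∧
      ∀ s ∈ Icc a b, ∀ t ∈ Icc a b, s ≤ t → |f t - f s| ≤ ν.real (Icc s t) := by
  have hproj : BoundedVariationOn (f ∘ fun t => (projIcc a b hab t : ℝ)) univ :=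
    ne_top_of_le_ne_top hbv (eVariationOn.comp_le_of_monotoneOn f _
      (((Subtype.mono_coe _).comp (monotone_projIcc hab)).monotoneOn _) fun t _ =>
        Subtype.coe_prop _)
  obtain ⟨ν, hν, hdom⟩ := exists_measure_dominating_of_boundedVariationOn
    (hf.comp (continuous_subtype_val.comp continuous_projIcc)) hproj
  refine ⟨ν, hν, fun s hs t ht hst => ?_⟩
  simpa [projIcc_of_mem hab hs, projIcc_of_mem hab ht] using hdom s t hst

theorem exists_lift_of_isPreconnected {A : Set UnitAddCircle} (hA : IsPreconnected A) {v : ℝ}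
    (hv : (v : UnitAddCircle) ∉ A) {x y : UnitAddCircle} (hx : x ∈ A) (hy : y ∈ A) :
    ∃ s ∈ Ico v (v + 1), ∃ t ∈ Ico v (v + 1), (s : UnitAddCircle) = x ∧ (t : UnitAddCircle) = y ∧
      ∀ r ∈ uIcc s t, (r : UnitAddCircle) ∈ A := by
  let lift : UnitAddCircle → ℝ := fun z => AddCircle.equivIco 1 v z
  have hlift : ∀ z, (lift z : UnitAddCircle) = z := (AddCircle.equivIco 1 v).symm_apply_apply
  have hcont : ContinuousOn lift A := fun z hz =>
    (continuous_subtype_val.continuousAt.comp (AddCircle.continuousAt_equivIco 1 v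
      (ne_of_mem_of_not_mem hz hv))).continuousWithinAt
  refine ⟨lift x, Subtype.coe_prop _, lift y, Subtype.coe_prop _, hlift x, hlift y, fun r hr => ?_⟩
  obtain ⟨z, hz, rfl⟩ := (hA.image lift hcont).ordConnected.uIcc_subset
    (mem_image_of_mem lift hx) (mem_image_of_mem lift hy) hr
  rwa [hlift]

theorem exists_lift_nonneg_of_isPreconnected {A : Set UnitAddCircle} (hA : IsPreconnected A)
    {x y : UnitAddCircle} (hx : x ∈ A) (hy : y ∈ A) :
    ∃ s ∈ Icc (0 : ℝ) 2, ∃ t ∈ Icc (0 : ℝ) 2, |t - s| < 1 ∧ (s : UnitAddCircle) = x ∧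
      (t : UnitAddCircle) = y ∧ ∀ r ∈ uIcc s t, (r : UnitAddCircle) ∈ A := by
  by_cases hfull : ∃ z, z ∉ A
  · obtain ⟨z, hz⟩ := hfull
    obtain ⟨v, hv, rfl⟩ := AddCircle.eq_coe_Ico z
    obtain ⟨s, hs, t, ht, hsx, hty, hst⟩ := exists_lift_of_isPreconnected hA hz hx hy
    exact ⟨s, ⟨by linarith [hv.1, hs.1], by linarith [hv.2, hs.2]⟩, t,
      ⟨by linarith [hv.1, ht.1], by linarith [hv.2, ht.2]⟩,
      abs_sub_lt_iff.2 ⟨by linarith [ht.2, hs.1], by linarith [ht.1, hs.2]⟩, hsx, hty, hst⟩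
  · obtain ⟨s, hs, rfl⟩ := AddCircle.eq_coe_Ico x
    obtain ⟨t, ht, rfl⟩ := AddCircle.eq_coe_Ico y
    push Not at hfull
    exact ⟨s, ⟨hs.1, by linarith [hs.2]⟩, t, ⟨ht.1, by linarith [ht.2]⟩,
      abs_sub_lt_iff.2 ⟨by linarith [ht.2, hs.1], by linarith [ht.1, hs.2]⟩, rfl, rfl,
      fun r _ => hfull r⟩

theorem abs_sub_le_measureReal_preimage_coe {F : UnitAddCircle → ℝ} {ν : Measure ℝ}
    [IsFiniteMeasure ν]
    (hν : ∀ s ∈ Icc (0 : ℝ) 1, ∀ t ∈ Icc (0 : ℝ) 1, s ≤ t → |F t - F s| ≤ ν.real (Icc s t))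
    {A : Set UnitAddCircle} {s t : ℝ} (hs : 0 ≤ s) (hst : s ≤ t) (hts : t < s + 1) (ht : t ≤ 2)
    (hA : ∀ r ∈ Icc s t, (r : UnitAddCircle) ∈ A) :
    |F t - F s| ≤ ν.real ((↑) ⁻¹' A : Set ℝ) := by
  have hshift : ∀ r : ℝ, ((r - 1 : ℝ) : UnitAddCircle) = r := fun r => by simp
  have hA' : ∀ r : ℝ, r + 1 ∈ Icc s t → (r : UnitAddCircle) ∈ A := fun r hr => by
    simpa using hA _ hr
  rcases le_total t 1 with ht1 | ht1
  · exact (hν s ⟨hs, hst.trans ht1⟩ t ⟨hs.trans hst, ht1⟩ hst).trans (measureReal_mono hA)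
  rcases le_total 1 s with hs1 | hs1
  · rw [← hshift s, ← hshift t]
    refine (hν (s - 1) ⟨by linarith, by linarith⟩ (t - 1) ⟨by linarith, by linarith⟩
      (by linarith)).trans (measureReal_mono fun r hr => hA' r ⟨?_, ?_⟩) <;>
    linarith [hr.1, hr.2]
  have hdisj : Disjoint (Icc s 1) (Icc 0 (t - 1)) :=
    disjoint_left.2 fun r hr hr' => by linarith [hr.1, hr'.2]
  calc |F t - F s| = |(F (1 : ℝ) - F s) + (F (t - 1 : ℝ) - F (0 : ℝ))| := by
        rw [hshift, ← hshift 1, sub_self]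
        ring_nf
    _ ≤ ν.real (Icc s 1) + ν.real (Icc 0 (t - 1)) :=
        (abs_add_le _ _).trans (add_le_add (hν s ⟨hs, hs1⟩ 1 (by simp) hs1)
          (hν 0 (by simp) (t - 1) ⟨by linarith, by linarith⟩ (by linarith)))
    _ = ν.real (Icc s 1 ∪ Icc 0 (t - 1)) :=
        (measureReal_union hdisj measurableSet_Icc).symm
    _ ≤ ν.real ((↑) ⁻¹' A : Set ℝ) := by
        refine measureReal_mono (union_subset (fun r hr => hA r ⟨hr.1, hr.2.trans ht1⟩)
          fun r hr => hA' r ⟨?_, ?_⟩) <;>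
        linarith [hr.1, hr.2]

theorem exists_dominatesVariation {F : C(UnitAddCircle, ℝ)}
    (hF : BoundedVariationOn (fun t : ℝ => F (t : UnitAddCircle)) (Icc 0 1)) :
    ∃ μ : Measure UnitAddCircle, IsFiniteMeasure μ ∧ DominatesVariation μ F := by
  obtain ⟨ν, hfin, hν⟩ := exists_measure_dominating_on_Icc zero_le_one
    (F.continuous.comp (AddCircle.continuous_mk' 1)) hF
  have hcoe : AEMeasurable ((↑) : ℝ → UnitAddCircle) ν :=
    (AddCircle.continuous_mk' 1).measurable.aemeasurable
  refine ⟨ν.map (↑), inferInstance, fun A hA x hx y hy => ?_⟩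
  refine le_trans ?_ (ENNReal.toReal_mono (measure_ne_top _ _) (Measure.le_map_apply hcoe A))
  obtain ⟨s, hs, t, ht, hst, rfl, rfl, hA'⟩ := exists_lift_nonneg_of_isPreconnected hA hx hy
  rw [abs_sub_lt_iff] at hst
  rcases le_total s t with hle | hle
  · rw [uIcc_of_le hle] at hA'
    exact abs_sub_le_measureReal_preimage_coe hν hs.1 hle (by linarith) ht.2 hA'
  · rw [uIcc_of_ge hle] at hA'
    rw [abs_sub_comm]
    exact abs_sub_le_measureReal_preimage_coe hν ht.1 hle (by linarith) hs.2 hA'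

end Variation

section RationalApproximation

/-- The fraction `r = p / q` in lowest terms satisfies the bound `|α - p / q| ≤ 1 / q²` of
Dirichlet's approximation theorem. -/
def IsDirichletApprox (α : ℝ) (r : ℚ) : Prop := |α - r| ≤ 1 / (r.den : ℝ) ^ 2

theorem exists_isDirichletApprox {α : ℝ} (hα : Irrational α) (N : ℕ) :
    ∃ r, IsDirichletApprox α r ∧ N < r.den := by
  obtain ⟨ε, hε, hε0 : 0 < ε⟩ := ((hα.eventually_forall_le_dist_cast_rat_of_den_le N).filter_mono
    nhdsWithin_le_nhds |>.and (self_mem_nhdsWithin (s := Ioi (0 : ℝ)))).exists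
  obtain ⟨m, hm⟩ := exists_nat_gt (1 / ε)
  have hm0 : (0 : ℝ) < m := lt_trans (by positivity) hm
  obtain ⟨r, hr, hrm⟩ := Real.exists_rat_abs_sub_le_and_den_le α (Nat.cast_pos.1 hm0)
  have hrm' : (r.den : ℝ) ≤ m := Nat.cast_le.2 hrm
  have hden : (1 : ℝ) ≤ r.den := Nat.one_le_cast.2 r.pos
  refine ⟨r, hr.trans ?_, ?_⟩
  · rw [pow_two]
    gcongr
    linarith
  · by_contra! hN
    refine (hε r hN).not_gt ?_
    calc dist α r ≤ 1 / ((m + 1) * r.den) := hr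
      _ ≤ 1 / m := by
        gcongr
        nlinarith
      _ < ε := by rwa [div_lt_comm₀ hm0 hε0]

theorem circleRotation_iterate_apply (α x : UnitAddCircle) (n : ℕ) :
    (circleRotation α)^[n] x = x + n • α :=
  congrFun (add_right_iterate α n) x

theorem coe_sub_nsmul_coe (t α : ℝ) (j : ℕ) :
    (t : UnitAddCircle) - j • (α : UnitAddCircle) = ((t - j * α : ℝ) : UnitAddCircle) := by
  rw [AddCircle.coe_sub, ← nsmul_eq_mul, AddCircle.coe_nsmul]

namespace IsDirichletApprox

variable {α : ℝ} {r : ℚ}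

theorem abs_mul_sub_le (hr : IsDirichletApprox α r) {j : ℕ} (hj : j ≤ r.den) :
    |j * α - j * r.num / r.den| ≤ 1 / r.den := by
  rw [mul_div_assoc, ← Rat.cast_def, ← mul_sub, abs_mul, Nat.abs_cast]
  calc (j : ℝ) * |α - r| ≤ r.den * (1 / r.den ^ 2) := by
        gcongr
        exact hr
    _ = 1 / r.den := by field_simp

end IsDirichletApprox

theorem eq_of_den_dvd_mul_num_sub {r : ℚ} {i j : ℕ} (hi : i < r.den) (hj : j < r.den)
    (h : (r.den : ℤ) ∣ i * r.num - j * r.num) : i = j := by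
  rw [← sub_mul] at h
  have hzero := Int.eq_zero_of_abs_lt_dvd (r.isCoprime_num_den.symm.dvd_of_dvd_mul_right h)
    (by rw [abs_lt]; omega)
  omega

theorem exists_lt_den_dvd_sub_mul_num (r : ℚ) (m : ℤ) :
    ∃ j < r.den, (r.den : ℤ) ∣ m - j * r.num := by
  obtain ⟨u, v, huv⟩ := r.isCoprime_num_den
  obtain ⟨j, hj, hjm⟩ := Int.existsUnique_equiv_nat (m * u) (Nat.cast_pos.2 r.pos)
  refine ⟨j, Nat.cast_lt.1 hj, ?_⟩
  have hdvd : (r.den : ℤ) ∣ (m * u - j) * r.num + m * v * r.den :=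
    dvd_add (hjm.dvd.mul_right _) (dvd_mul_left _ _)
  rwa [show (m * u - j) * r.num + m * v * r.den = m - j * r.num by
    linear_combination m * huv] at hdvd

namespace IsDirichletApprox

variable {α : ℝ} {r : ℚ}

theorem exists_norm_sub_nsmul_le (hr : IsDirichletApprox α r) (y : UnitAddCircle) :
    ∃ j < r.den, ‖y - j • (α : UnitAddCircle)‖ ≤ 3 / (2 * r.den) := by
  have hden : (0 : ℝ) < r.den := Nat.cast_pos.2 r.pos
  obtain ⟨t, -, rfl⟩ := AddCircle.eq_coe_Ico y
  obtain ⟨j, hj, k, hk⟩ := exists_lt_den_dvd_sub_mul_num r (round (t * r.den))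
  refine ⟨j, hj, ?_⟩
  have hround : (round (t * r.den) : ℝ) = j * r.num + r.den * k := by
    exact_mod_cast eq_add_of_sub_eq' hk
  have hsplit : t - j * α - k = (t * r.den - round (t * r.den)) / r.den -
      (j * α - j * r.num / r.den) := by
    rw [hround]
    field_simp
    ring
  have hmod : ((t - j * α : ℝ) : UnitAddCircle) = ((t - j * α - k : ℝ) : UnitAddCircle) := by
    rw [AddCircle.coe_sub 1 _ (k : ℝ), (AddCircle.coe_eq_zero_iff 1 (x := (k : ℝ))).2 ⟨k, by simp⟩,
      sub_zero]
  rw [coe_sub_nsmul_coe, hmod]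
  calc ‖((t - j * α - k : ℝ) : UnitAddCircle)‖ ≤ |t - j * α - k| :=
        QuotientAddGroup.norm_mk_le_norm
    _ ≤ |t * r.den - round (t * r.den)| / r.den + |j * α - j * r.num / r.den| := by
        rw [hsplit, ← abs_of_pos hden, ← abs_div, abs_of_pos hden]
        exact abs_sub _ _
    _ ≤ 1 / 2 / r.den + 1 / r.den := by
        gcongr
        exacts [abs_sub_round _, hr.abs_mul_sub_le hj.le]
    _ = 3 / (2 * r.den) := by
        field_simp
        norm_num

theorem exists_int_abs_sub_lt (hr : IsDirichletApprox α r) {t : ℝ} {j : ℕ} (hj : j < r.den)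
    (h : ‖(t : UnitAddCircle) - j • (α : UnitAddCircle)‖ < 2 / r.den) :
    ∃ m : ℤ, |t * r.den - m| < 3 ∧ (r.den : ℤ) ∣ m - j * r.num := by
  have hden : (0 : ℝ) < r.den := Nat.cast_pos.2 r.pos
  rw [coe_sub_nsmul_coe, UnitAddCircle.norm_eq] at h
  refine ⟨j * r.num + r.den * round (t - j * α), ?_, ⟨_, add_sub_cancel_left _ _⟩⟩
  have hsplit : t * r.den - (j * r.num + r.den * round (t - j * α) : ℤ) =
      ((t - j * α - round (t - j * α)) + (j * α - j * r.num / r.den)) * r.den := by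
    push_cast
    field_simp
    ring
  rw [hsplit, abs_mul, abs_of_pos hden, ← lt_div_iff₀ hden]
  calc |(t - j * α - round (t - j * α)) + (j * α - j * r.num / r.den)|
    _ ≤ |t - j * α - round (t - j * α)| + |j * α - j * r.num / r.den| := abs_add_le _ _
    _ < 2 / r.den + 1 / r.den := add_lt_add_of_lt_of_le h (hr.abs_mul_sub_le hj.le)
    _ = 3 / r.den := by ring

theorem card_norm_sub_nsmul_lt_le (hr : IsDirichletApprox α r) (y : UnitAddCircle) :
    ((Finset.range r.den).filter fun j => ‖y - j • (α : UnitAddCircle)‖ < 2 / r.den).card ≤ 7 := by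
  obtain ⟨t, -, rfl⟩ := AddCircle.eq_coe_Ico y
  set s := (Finset.range r.den).filter fun j =>
    ‖(t : UnitAddCircle) - j • (α : UnitAddCircle)‖ < 2 / r.den
  have hlt : ∀ j ∈ s, j < r.den := fun j hj => Finset.mem_range.1 (Finset.mem_filter.1 hj).1
  choose! m hm hdvd using fun j (hj : j ∈ s) =>
    hr.exists_int_abs_sub_lt (hlt j hj) (Finset.mem_filter.1 hj).2
  have hinj : InjOn m s := fun i hi j hj hij => by
    refine eq_of_den_dvd_mul_num_sub (hlt i hi) (hlt j hj) ?_
    simpa [hij] using dvd_sub (hdvd j hj) (hdvd i hi)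
  have hmaps : MapsTo m s (Finset.Icc (⌊t * r.den⌋ - 3) (⌊t * r.den⌋ + 3)) := fun j hj => by
    obtain ⟨hleft, hright⟩ := abs_lt.1 (hm j hj)
    rw [Finset.coe_Icc, mem_Icc, ← sub_nonneg, ← Int.lt_add_one_iff (a := m j),
      sub_sub_eq_add_sub, sub_nonneg, ← Int.lt_add_one_iff (b := m j + 3), Int.floor_lt,
      ← sub_lt_iff_lt_add, ← sub_lt_iff_lt_add, Int.lt_iff_add_one_le, Int.le_floor]
    push_cast
    constructor <;> linarith
  refine (Finset.card_le_card_of_injOn m hmaps hinj).trans ?_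
  rw [Int.card_Icc]
  omega

theorem sum_indicator_ball_le (hr : IsDirichletApprox α r) (x z : UnitAddCircle) :
    ∑ j ∈ Finset.range r.den, (Metric.ball (x + j • (α : UnitAddCircle)) (2 / r.den)).indicator
      (1 : UnitAddCircle → ℝ) z ≤ 7 := by
  simp only [indicator, Metric.mem_ball, dist_eq_norm, sub_add_eq_sub_sub, Pi.one_apply,
    Finset.sum_boole]
  exact_mod_cast hr.card_norm_sub_nsmul_lt_le (z - x)

end IsDirichletApprox

end RationalApproximation

section Distortion

theorem isPreconnected_ball_unitAddCircle (x : UnitAddCircle) (δ : ℝ) :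
    IsPreconnected (Metric.ball x δ) := by
  obtain ⟨t, -, rfl⟩ := AddCircle.eq_coe_Ico x
  have himage : Metric.ball (t : UnitAddCircle) δ = (↑) '' Metric.ball t δ := by
    ext y
    rw [mem_ball_iff_norm, QuotientAddGroup.norm_lt_iff]
    constructor
    · rintro ⟨d, hd, hdδ⟩
      exact ⟨t + d, by simpa using hdδ, by rw [AddCircle.coe_add, hd, add_sub_cancel]⟩
    · rintro ⟨s, hs, rfl⟩
      exact ⟨s - t, AddCircle.coe_sub .., mem_ball_iff_norm.1 hs⟩
  rw [himage]
  exact (convex_ball t δ).isPreconnected.image _ (AddCircle.continuous_mk' 1).continuousOn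

theorem sum_measureReal_le {ι X : Type*} [MeasurableSpace X] (μ : Measure X)
    [IsFiniteMeasure μ] (s : Finset ι) {B : ι → Set X} (hB : ∀ i ∈ s, MeasurableSet (B i)) {k : ℝ}
    (hk : ∀ x, ∑ i ∈ s, (B i).indicator (1 : X → ℝ) x ≤ k) :
    ∑ i ∈ s, μ.real (B i) ≤ k * μ.real univ := by
  have hintegrable : ∀ i ∈ s, Integrable ((B i).indicator (1 : X → ℝ)) μ := fun i hi =>
    (integrable_const 1).indicator (hB i hi)
  calc ∑ i ∈ s, μ.real (B i) = ∫ x, ∑ i ∈ s, (B i).indicator (1 : X → ℝ) x ∂μ := by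
        rw [integral_finsetSum _ hintegrable]
        exact Finset.sum_congr rfl fun i hi => (integral_indicator_one (hB i hi)).symm
    _ ≤ ∫ _, k ∂μ :=
        integral_mono (integrable_finsetSum _ hintegrable) (integrable_const _) hk
    _ = k * μ.real univ := by simp [mul_comm]

theorem abs_birkhoffSum_sub_le {μ : Measure UnitAddCircle} [IsFiniteMeasure μ]
    {W : C(UnitAddCircle, ℝ)} (hW : DominatesVariation μ W) {α : ℝ} {r : ℚ}
    (hr : IsDirichletApprox α r) {n : ℕ} (hn : n ≤ r.den) {x y : UnitAddCircle}
    (hxy : ‖y - x‖ < 2 / r.den) :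
    |birkhoffSum (circleRotation α) W n y - birkhoffSum (circleRotation α) W n x| ≤
      7 * μ.real univ := by
  let B : ℕ → Set UnitAddCircle := fun i => Metric.ball (x + i • (α : UnitAddCircle)) (2 / r.den)
  have hosc : ∀ i, |W (y + i • (α : UnitAddCircle)) - W (x + i • (α : UnitAddCircle))| ≤
      μ.real (B i) := fun i =>
    hW _ (isPreconnected_ball_unitAddCircle _ _) _
      (Metric.mem_ball_self ((norm_nonneg _).trans_lt hxy)) _ (by
        rwa [mem_ball_iff_norm, add_sub_add_right_eq_sub])
  simp only [birkhoffSum, circleRotation_iterate_apply, ← Finset.sum_sub_distrib]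
  calc _ ≤ ∑ i ∈ Finset.range n, μ.real (B i) :=
        (Finset.abs_sum_le_sum_abs _ _).trans (Finset.sum_le_sum fun i _ => hosc i)
    _ ≤ ∑ i ∈ Finset.range r.den, μ.real (B i) :=
        Finset.sum_le_sum_of_subset_of_nonneg (Finset.range_mono hn) fun _ _ _ =>
          measureReal_nonneg
    _ ≤ 7 * μ.real univ :=
        sum_measureReal_le μ _ (fun _ _ => measurableSet_ball) (hr.sum_indicator_ball_le x)

end Distortion

section Comparison

namespace IsConformal

variable {X : Type*} [TopologicalSpace X] {φ : X ≃ₜ X} {W : C(X, ℝ)}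
  {M M₁ M₂ : C(X, ℝ) →ₗ[ℝ] ℝ}

theorem sum_map_expMap_birkhoffSum_mul (hM : IsConformal φ W M) (n : ℕ) (t : C(X, ℝ)) :
    ∑ j ∈ Finset.range n, M (expMap (birkhoffSum (koopman ℝ φ) id j W) * t) =
      M (∑ j ∈ Finset.range n, (koopman ℝ φ.symm)^[j] t) := by
  simp only [map_sum, hM.map_koopman_symm_iterate]

theorem exp_mul_le_of_distortion (hM : IsConformal φ W M) {t V : C(X, ℝ)} (ht : 0 ≤ t)
    {x : X} {C : ℝ} (hC : ∀ y, t y ≠ 0 → |V y - V x| ≤ C) :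
    Real.exp (V x) * M t ≤ Real.exp C * M (expMap V * t) := by
  simp only [← smul_eq_mul, ← map_smul]
  refine hM.mono fun y => ?_
  rcases eq_or_ne (t y) 0 with hy | hy
  · simp [hy]
  · have hexp : Real.exp (V x) ≤ Real.exp C * Real.exp (V y) := by
      rw [← Real.exp_add, Real.exp_le_exp]
      linarith [(abs_le.1 (hC y hy)).1]
    simpa [mul_assoc] using mul_le_mul_of_nonneg_right hexp (ht y)

theorem map_mul_le_of_distortion (hM : IsConformal φ W M) {t V : C(X, ℝ)} (ht : 0 ≤ t)
    {x : X} {C : ℝ} (hC : ∀ y, t y ≠ 0 → |V y - V x| ≤ C) :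
    M (expMap V * t) ≤ Real.exp C * (Real.exp (V x) * M t) := by
  simp only [← smul_eq_mul, ← map_smul]
  refine hM.mono fun y => ?_
  rcases eq_or_ne (t y) 0 with hy | hy
  · simp [hy]
  · have hexp : Real.exp (V y) ≤ Real.exp C * Real.exp (V x) := by
      rw [← Real.exp_add, Real.exp_le_exp]
      linarith [(abs_le.1 (hC y hy)).2]
    simpa [mul_assoc] using mul_le_mul_of_nonneg_right hexp (ht y)

theorem mul_le_mul_of_distortion (h₁ : IsConformal φ W M₁) (h₂ : IsConformal φ W M₂)
    {t : C(X, ℝ)} (ht : 0 ≤ t) {n : ℕ} {a b : ℝ} (ha : 0 < a)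
    (hab : ∀ y, ∑ j ∈ Finset.range n, t (φ.symm^[j] y) ∈ Icc a b) {x : X} {C : ℝ}
    (hC : ∀ j < n, ∀ y, t y ≠ 0 → |birkhoffSum φ W j y - birkhoffSum φ W j x| ≤ C) :
    a * M₁ t ≤ b * Real.exp C ^ 2 * M₂ t := by
  set S : ℕ → C(X, ℝ) := fun j => birkhoffSum (koopman ℝ φ) id j W
  set L := ∑ j ∈ Finset.range n, Real.exp (S j x)
  have hdist : ∀ j ∈ Finset.range n, ∀ y, t y ≠ 0 → |S j y - S j x| ≤ C := by
    simpa only [Finset.mem_range, S, birkhoffSum_koopman_apply, ContinuousMap.coe_coe] using hC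
  have hsum : ∀ y, (∑ j ∈ Finset.range n, (koopman ℝ φ.symm)^[j] t) y ∈ Icc a b := by
    simpa only [ContinuousMap.sum_apply, koopman_iterate_apply, ContinuousMap.coe_coe] using hab
  have hupper : L * M₁ t ≤ Real.exp C * b := by
    rw [Finset.sum_mul]
    refine (Finset.sum_le_sum fun j hj => h₁.exp_mul_le_of_distortion ht (hdist j hj)).trans ?_
    rw [← Finset.mul_sum, h₁.sum_map_expMap_birkhoffSum_mul, ← h₁.map_const b]
    gcongr
    exact h₁.mono fun y => (hsum y).2
  have hlower : a ≤ Real.exp C * (L * M₂ t) := by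
    rw [Finset.sum_mul, Finset.mul_sum]
    refine le_trans ?_ (Finset.sum_le_sum fun j hj =>
      h₂.map_mul_le_of_distortion ht (hdist j hj))
    rw [h₂.sum_map_expMap_birkhoffSum_mul, ← h₂.map_const a]
    exact h₂.mono fun y => (hsum y).1
  have hL : 0 < L := by
    refine (Finset.sum_nonneg fun j _ => (Real.exp_pos _).le).lt_of_ne' fun hL : L = 0 => ?_
    rw [hL, zero_mul, mul_zero] at hlower
    exact hlower.not_gt ha
  refine le_of_mul_le_mul_left ?_ hL
  calc L * (a * M₁ t) = a * (L * M₁ t) := mul_left_comm ..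
    _ ≤ Real.exp C * (L * M₂ t) * (Real.exp C * b) := by
        exact mul_le_mul hlower hupper (mul_nonneg hL.le (h₁.nonneg t ht)) (ha.le.trans hlower)
    _ = L * (b * Real.exp C ^ 2 * M₂ t) := by ring

theorem mul_le_mul_of_partition (h₁ : IsConformal φ W M₁) (h₂ : IsConformal φ W M₂) {ι : Type*}
    {s : Finset ι} {t : ι → C(X, ℝ)} (ht : ∀ i ∈ s, 0 ≤ t i) {a b K : ℝ}
    (hab : ∀ y, ∑ i ∈ s, t i y ∈ Icc a b) (hK₀ : 0 ≤ K) (hK : ∀ i ∈ s, M₁ (t i) ≤ K * M₂ (t i))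
    {g : C(X, ℝ)} (hg : 0 ≤ g) {x : ι → X} {ε : ℝ} (hε : 0 ≤ ε)
    (hx : ∀ i ∈ s, ∀ y, t i y ≠ 0 → |g y - g (x i)| ≤ ε) :
    a * M₁ g ≤ K * (b * (M₂ g + 2 * ε)) := by
  set k : C(X, ℝ) := ∑ i ∈ s, (g (x i) + ε) • t i
  have hk : ∀ y, k y = ∑ i ∈ s, (g (x i) + ε) * t i y := fun y => by
    simp [k, ContinuousMap.sum_apply]
  have hlower : a • g ≤ k := fun y => by
    calc a * g y ≤ (∑ i ∈ s, t i y) * g y := mul_le_mul_of_nonneg_right (hab y).1 (hg y)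
      _ = ∑ i ∈ s, g y * t i y := by rw [mul_comm, Finset.mul_sum]
      _ ≤ k y := by
        rw [hk]
        refine Finset.sum_le_sum fun i hi => ?_
        rcases eq_or_ne (t i y) 0 with hy | hy
        · simp [hy]
        · exact mul_le_mul_of_nonneg_right (by linarith [(abs_le.1 (hx i hi y hy)).2]) (ht i hi y)
  have hupper : k ≤ b • (g + .const X (2 * ε)) := fun y => by
    calc k y ≤ ∑ i ∈ s, (g y + 2 * ε) * t i y := by
          rw [hk]
          refine Finset.sum_le_sum fun i hi => ?_
          rcases eq_or_ne (t i y) 0 with hy | hy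
          · simp [hy]
          · exact mul_le_mul_of_nonneg_right (by linarith [(abs_le.1 (hx i hi y hy)).1]) (ht i hi y)
      _ = (∑ i ∈ s, t i y) * (g y + 2 * ε) := by rw [← Finset.mul_sum, mul_comm]
      _ ≤ b * (g y + 2 * ε) :=
          mul_le_mul_of_nonneg_right (hab y).2 (add_nonneg (hg y) (by positivity))
  calc a * M₁ g ≤ M₁ k := by simpa using h₁.mono hlower
    _ ≤ K * M₂ k := by
        simp only [k, map_sum, map_smul, smul_eq_mul, Finset.mul_sum, mul_left_comm K]
        exact Finset.sum_le_sum fun i hi =>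
          mul_le_mul_of_nonneg_left (hK i hi) (add_nonneg (hg _) hε)
    _ ≤ K * (b * (M₂ g + 2 * ε)) := by
        gcongr
        simpa [h₂.map_const, mul_add] using h₂.mono hupper

end IsConformal

section Tent

variable {E : Type*} [SeminormedAddCommGroup E]

/-- The tent function of height `1` and radius `δ` centred at `x`. -/
noncomputable def tent (δ : ℝ) (x : E) : C(E, ℝ) := ⟨fun y => max 0 (1 - ‖y - x‖ / δ), by fun_prop⟩

theorem tent_nonneg (δ : ℝ) (x : E) : 0 ≤ tent δ x := fun _ => le_max_left _ _

theorem tent_sub (δ : ℝ) (x y z : E) : tent δ x (y - z) = tent δ (x + z) y := by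
  simp [tent, sub_sub, add_comm]

variable {δ : ℝ}

theorem norm_sub_lt_of_tent_ne_zero (hδ : 0 < δ) {x y : E} (h : tent δ x y ≠ 0) : ‖y - x‖ < δ := by
  contrapose! h
  exact max_eq_left (sub_nonpos.2 ((one_le_div hδ).2 h))

theorem tent_le_indicator_ball (hδ : 0 < δ) (x y : E) :
    tent δ x y ≤ (Metric.ball x δ).indicator 1 y := by
  by_cases hy : y ∈ Metric.ball x δ
  · rw [indicator_of_mem hy]
    exact max_le zero_le_one (sub_le_self _ (by positivity))
  · rw [indicator_of_notMem hy]
    exact (not_ne_iff.1 fun h => hy (mem_ball_iff_norm.2 (norm_sub_lt_of_tent_ne_zero hδ h))).le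

end Tent

theorem circleRotation_symm_iterate_apply (α x : UnitAddCircle) (n : ℕ) :
    (circleRotation α).symm^[n] x = x - n • α := by
  rw [sub_eq_add_neg, ← smul_neg]
  exact circleRotation_iterate_apply (-α) x n

variable {α : ℝ} {r : ℚ} {μ : Measure UnitAddCircle} [IsFiniteMeasure μ]
  {W : C(UnitAddCircle, ℝ)} {M₁ M₂ : C(UnitAddCircle, ℝ) →ₗ[ℝ] ℝ}

theorem IsDirichletApprox.sum_tent_mem_Icc (hr : IsDirichletApprox α r) (x y : UnitAddCircle) :
    ∑ j ∈ Finset.range r.den, tent (2 / r.den) (x + j • (α : UnitAddCircle)) y ∈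
      Icc (1 / 4 : ℝ) 7 := by
  constructor
  · obtain ⟨j, hj, hle⟩ := hr.exists_norm_sub_nsmul_le (y - x)
    refine le_trans (le_max_of_le_right ?_) (Finset.single_le_sum
      (f := fun j : ℕ => tent (2 / r.den) (x + j • (α : UnitAddCircle)) y)
      (fun j _ => tent_nonneg _ _ y) (Finset.mem_range.2 hj))
    calc (1 / 4 : ℝ) = 1 - 3 / (2 * r.den) / (2 / r.den) := by
          field_simp
          norm_num
      _ ≤ 1 - ‖y - (x + j • (α : UnitAddCircle))‖ / (2 / r.den) := by
          rw [← sub_sub]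
          gcongr
  · have hδ : (0 : ℝ) < 2 / r.den := div_pos two_pos (Nat.cast_pos.2 r.pos)
    exact (Finset.sum_le_sum fun j _ => tent_le_indicator_ball hδ _ y).trans
      (hr.sum_indicator_ball_le x y)

namespace IsConformal

theorem tent_le (h₁ : IsConformal (circleRotation α) W M₁)
    (h₂ : IsConformal (circleRotation α) W M₂) (hW : DominatesVariation μ W)
    (hr : IsDirichletApprox α r) (x : UnitAddCircle) :
    M₁ (tent (2 / r.den) x) ≤ 28 * Real.exp (7 * μ.real univ) ^ 2 * M₂ (tent (2 / r.den) x) := by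
  have hδ : (0 : ℝ) < 2 / r.den := div_pos two_pos (Nat.cast_pos.2 r.pos)
  have hquarter := h₁.mul_le_mul_of_distortion h₂ (tent_nonneg (2 / r.den) x) (n := r.den)
    (by positivity : (0 : ℝ) < 1 / 4) (fun y => by
      simpa only [circleRotation_symm_iterate_apply, tent_sub] using hr.sum_tent_mem_Icc x y)
    (fun j hj y hy => abs_birkhoffSum_sub_le hW hr hj.le
      (norm_sub_lt_of_tent_ne_zero hδ hy))
  linarith

theorem le_const_mul (hα : Irrational α) (h₁ : IsConformal (circleRotation α) W M₁)
    (h₂ : IsConformal (circleRotation α) W M₂) (hW : DominatesVariation μ W)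
    {g : C(UnitAddCircle, ℝ)} (hg : 0 ≤ g) :
    M₁ g ≤ 784 * Real.exp (7 * μ.real univ) ^ 2 * M₂ g := by
  set K := Real.exp (7 * μ.real univ) ^ 2
  have hK : 0 < K := by positivity
  suffices h : ∀ ε : ℝ, 0 < ε → M₁ g ≤ 784 * K * M₂ g + 1568 * K * ε by
    refine le_of_forall_pos_le_add fun δ hδ => (h (δ / (1568 * K)) (by positivity)).trans_eq ?_
    field_simp
  intro ε hε
  obtain ⟨δ, hδ, hgδ⟩ := Metric.uniformContinuous_iff.1
    (CompactSpace.uniformContinuous_of_continuous g.continuous) ε hε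
  obtain ⟨N, hN⟩ := exists_nat_gt (2 / δ)
  obtain ⟨r, hr, hNr⟩ := exists_isDirichletApprox hα N
  have hden : (0 : ℝ) < r.den := Nat.cast_pos.2 r.pos
  have hrδ : 2 / r.den < δ := by
    rw [div_lt_comm₀ hden hδ]
    exact hN.trans (Nat.cast_lt.2 hNr)
  have hpartition := h₁.mul_le_mul_of_partition h₂ (s := Finset.range r.den)
    (fun j _ => tent_nonneg (2 / r.den) _) (hr.sum_tent_mem_Icc 0) (by positivity)
    (fun j _ => h₁.tent_le h₂ hW hr _) hg hε.le fun j _ y hy =>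
      (hgδ (dist_eq_norm y _ ▸ (norm_sub_lt_of_tent_ne_zero (by positivity) hy).trans hrδ)).le
  linarith

theorem eq_of_dominatesVariation (hα : Irrational α) (h₁ : IsConformal (circleRotation α) W M₁)
    (h₂ : IsConformal (circleRotation α) W M₂) (hW : DominatesVariation μ W) : M₁ = M₂ := by
  set K := 784 * Real.exp (7 * μ.real univ) ^ 2
  have hK : 1 < K := by
    have hexp := one_le_pow₀ (n := 2) (Real.one_le_exp (x := 7 * μ.real univ) (by positivity))
    linarith
  refine eq_of_comparable (inv_pos.2 (one_pos.trans hK)) (inv_lt_one_of_one_lt₀ hK) ?_ h₁ h₂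
  intro M₁ M₂ h₁ h₂ g hg
  rw [inv_mul_le_iff₀ (one_pos.trans hK)]
  exact h₁.le_const_mul hα h₂ hW hg

end IsConformal

end Comparison

section KMSCriterion

variable {A : Type*} [CStarAlgebra A] {α : ℝ → A ≃⋆ₐ[ℂ] A} {a b : A} {f g : ℂ → A}

namespace IsEntireExtension

theorem add (hf : IsEntireExtension α a f) (hg : IsEntireExtension α b g) :
    IsEntireExtension α (a + b) (f + g) :=
  ⟨hf.1.add hg.1, fun t => by rw [Pi.add_apply, hf.2, hg.2, map_add]⟩

theorem mul (hf : IsEntireExtension α a f) (hg : IsEntireExtension α b g) :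
    IsEntireExtension α (a * b) (f * g) :=
  ⟨hf.1.mul hg.1, fun t => by rw [Pi.mul_apply, hf.2, hg.2, map_mul]⟩

theorem const_algebraMap (c : ℂ) :
    IsEntireExtension α (algebraMap ℂ A c) fun _ => algebraMap ℂ A c :=
  ⟨differentiable_const _, fun t => (AlgHomClass.commutes (α t) c).symm⟩

theorem mul_eq_one (hf : IsEntireExtension α a f) (hg : IsEntireExtension α b g)
    (hab : a * b = 1) : f * g = 1 :=
  (hab ▸ hf.mul hg).unique ⟨differentiable_const 1, fun t => (map_one (α t)).symm⟩

end IsEntireExtension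

/-- The algebra of the entire analytic elements `a` that satisfy the KMS condition
`ω (a b) = ω (b α_{iβ}(a))` against every `b`. -/
def kmsSubalgebra (α : ℝ → A ≃⋆ₐ[ℂ] A) (β : ℝ) (ω : A →L[ℂ] ℂ) : Subalgebra ℂ A where
  carrier := {a | ∃ f, IsEntireExtension α a f ∧ ∀ b, ω (a * b) = ω (b * f (I * β))}
  mul_mem' := by
    rintro a₁ a₂ ⟨f, hf, hfω⟩ ⟨g, hg, hgω⟩
    exact ⟨f * g, hf.mul hg, fun b => by
      rw [mul_assoc, hfω, mul_assoc, hgω, mul_assoc, Pi.mul_apply]⟩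
  add_mem' := by
    rintro a₁ a₂ ⟨f, hf, hfω⟩ ⟨g, hg, hgω⟩
    exact ⟨f + g, hf.add hg, fun b => by
      rw [add_mul, map_add, hfω, hgω, Pi.add_apply, mul_add, map_add]⟩
  algebraMap_mem' c :=
    ⟨_, IsEntireExtension.const_algebraMap c, fun b => by rw [Algebra.commutes]⟩

variable {β : ℝ} {ω : A →L[ℂ] ℂ}

theorem mem_kmsSubalgebra_of_mul_eq_one (ha : a ∈ kmsSubalgebra α β ω) (hab : a * b = 1)
    (hba : b * a = 1) (hg : IsEntireExtension α b g) : b ∈ kmsSubalgebra α β ω := by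
  obtain ⟨f, hf, hfω⟩ := ha
  refine ⟨g, hg, fun c => ?_⟩
  have hgf : g (I * β) * f (I * β) = 1 := congrFun (hg.mul_eq_one hf hba) (I * β)
  calc ω (b * c) = ω (b * c * g (I * β) * f (I * β)) := by rw [mul_assoc (b * c), hgf, mul_one]
    _ = ω (a * (b * c * g (I * β))) := (hfω _).symm
    _ = ω (c * g (I * β)) := by rw [← mul_assoc, ← mul_assoc, hab, one_mul]

theorem IsKMSState.of_adjoin {s : Set A} (hs : Dense (StarAlgebra.adjoin ℂ s : Set A))
    (hαs : ∀ t, ∀ a ∈ s, α t a ∈ StarAlgebra.adjoin ℂ s) (hω : ∀ a, 0 ≤ ω (star a * a))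
    (hω1 : ω 1 = 1) (hkms : s ∪ star s ⊆ kmsSubalgebra α β ω) : IsKMSState α β ω := by
  have hinv : ∀ t, StarAlgebra.adjoin ℂ s ≤ (StarAlgebra.adjoin ℂ s).comap (α t : A →⋆ₐ[ℂ] A) :=
    fun t => StarAlgebra.adjoin_le (hαs t)
  refine ⟨hω, hω1, (StarAlgebra.adjoin ℂ s).toNonUnitalStarSubalgebra, hs,
    fun t a ha => hinv t ha, fun a ha => ?_⟩
  have hmem : a ∈ (StarAlgebra.adjoin ℂ s).toSubalgebra := ha
  rw [StarAlgebra.adjoin_toSubalgebra] at hmem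
  obtain ⟨f, hf, hfω⟩ := Algebra.adjoin_le hkms hmem
  exact ⟨f, hf, fun b _ => hfω b⟩

end KMSCriterion

section ComplexPhase

variable {X : Type u} [TopologicalSpace X]

/-- The function `x ↦ exp (-i z F x)`, the entire extension of `t ↦ phase F t`. -/
noncomputable def complexPhase (F : C(X, ℝ)) (z : ℂ) : C(X, ℂ) where
  toFun x := Complex.exp (-(I * z * F x))
  continuous_toFun := by fun_prop

theorem complexPhase_I_mul (F : C(X, ℝ)) (β : ℝ) (x : X) :
    complexPhase F (I * β) x = Complex.exp (β * F x) := by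
  rw [complexPhase, ContinuousMap.coe_mk, ← mul_assoc, Complex.I_mul_I, neg_one_mul, neg_mul,
    neg_neg]

theorem differentiable_complexPhase [CompactSpace X] (F : C(X, ℝ)) :
    Differentiable ℂ (complexPhase F) := by
  let G : C(X, ℂ) := ⟨fun x => -(I * F x), by fun_prop⟩
  have hexp : complexPhase F = fun z : ℂ => NormedSpace.exp (z • G) := by
    ext z x
    have heval := NormedSpace.map_exp (ContinuousMap.evalStarAlgHom ℂ ℂ x)
      (continuous_eval_const x) (z • G)
    rw [ContinuousMap.evalStarAlgHom_apply, ← Complex.exp_eq_exp_ℂ] at heval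
    rw [heval]
    refine congrArg Complex.exp ?_
    change _ = z * -(I * F x)
    ring
  rw [hexp]
  exact fun z => (hasDerivAt_exp_smul_const G z).differentiableAt

end ComplexPhase

namespace CrossedProduct

variable {X : Type u} [TopologicalSpace X] [CompactSpace X] {φ : X ≃ₜ X} {F : C(X, ℝ)}

theorem star_U_mul_U (φ : X ≃ₜ X) : star (U φ) * U φ = 1 :=
  Unitary.star_mul_self_of_mem (U_mem_unitary φ)

theorem U_mul_star_U (φ : X ≃ₜ X) : U φ * star (U φ) = 1 :=
  Unitary.mul_star_self_of_mem (U_mem_unitary φ)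

theorem crossedFlow_U (t : ℝ) : crossedFlow φ F t (U φ) = U φ * ofFunction φ (phase F t) := by
  simpa using crossedFlow_ofFunction_mul_U φ F t 1

theorem isEntireExtension_ofFunction (f : C(X, ℂ)) :
    IsEntireExtension (crossedFlow φ F) (ofFunction φ f) fun _ => ofFunction φ f :=
  ⟨differentiable_const _, fun _ => rfl⟩

theorem differentiable_ofFunction_complexPhase (φ : X ≃ₜ X) (F : C(X, ℝ)) :
    Differentiable ℂ fun z => ofFunction φ (complexPhase F z) :=
  (⟨(ofFunction φ).toAlgHom.toLinearMap, map_continuous (ofFunction φ)⟩ :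
    C(X, ℂ) →L[ℂ] CrossedProduct φ).differentiable.comp (differentiable_complexPhase F)

theorem isEntireExtension_U :
    IsEntireExtension (crossedFlow φ F) (U φ) fun z => U φ * ofFunction φ (complexPhase F z) :=
  ⟨(differentiable_ofFunction_complexPhase φ F).const_mul _, fun t => (crossedFlow_U t).symm⟩

theorem isEntireExtension_star_U : IsEntireExtension (crossedFlow φ F) (star (U φ))
    fun z => ofFunction φ (complexPhase F (-z)) * star (U φ) := by
  refine ⟨((differentiable_ofFunction_complexPhase φ F).comp differentiable_neg).mul_const _,
    fun t => ?_⟩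
  rw [map_star, crossedFlow_U, star_mul, ← map_star, star_phase]
  simp only [← Complex.ofReal_neg]
  rfl

theorem dense_adjoin (φ : X ≃ₜ X) :
    Dense (StarAlgebra.adjoin ℂ (insert (U φ) (range (ofFunction φ))) :
      Set (CrossedProduct φ)) := by
  refine Subtype.dense_iff.2 (closure_mono (Eq.ge ?_))
  have hmap := StarAlgHom.map_adjoin (productAdjoin φ).topologicalClosure.subtype
    (insert (U φ) (range (ofFunction φ)))
  rw [image_insert_eq, ← range_comp] at hmap
  exact congrArg SetLike.coe hmap

theorem generators_union_star_subset {s : Set (CrossedProduct φ)} (hf : ∀ f, ofFunction φ f ∈ s)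
    (hU : U φ ∈ s) (hU' : star (U φ) ∈ s) :
    insert (U φ) (range (ofFunction φ)) ∪ star (insert (U φ) (range (ofFunction φ))) ⊆ s := by
  refine union_subset (insert_subset hU (range_subset_iff.2 hf)) fun a ha => ?_
  rw [← star_star a]
  rcases mem_star.1 ha with ha | ⟨f, ha⟩
  · rwa [ha]
  · rw [← ha, ← map_star]
    exact hf _

theorem isKMSState_iff {β : ℝ} {ω : CrossedProduct φ →L[ℂ] ℂ} :
    IsKMSState (crossedFlow φ F) β ω ↔
      (∀ a, 0 ≤ ω (star a * a)) ∧ ω 1 = 1 ∧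
      (∀ f b, ω (ofFunction φ f * b) = ω (b * ofFunction φ f)) ∧
      ∀ b, ω (U φ * b) = ω (b * (U φ * ofFunction φ (complexPhase F (I * β)))) := by
  constructor
  · intro hω
    exact ⟨hω.nonneg, hω.map_one,
      fun f => hω.apply_mul_eq (crossedFlow_add φ F) (isEntireExtension_ofFunction f),
      hω.apply_mul_eq (crossedFlow_add φ F) isEntireExtension_U⟩
  · rintro ⟨hnonneg, hone, hf, hU⟩
    have hfmem : ∀ f, ofFunction φ f ∈ kmsSubalgebra (crossedFlow φ F) β ω :=
      fun f => ⟨_, isEntireExtension_ofFunction f, hf f⟩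
    have hUmem : U φ ∈ kmsSubalgebra (crossedFlow φ F) β ω := ⟨_, isEntireExtension_U, hU⟩
    have hU'mem : star (U φ) ∈ kmsSubalgebra (crossedFlow φ F) β ω :=
      mem_kmsSubalgebra_of_mul_eq_one hUmem (U_mul_star_U φ) (star_U_mul_U φ)
        isEntireExtension_star_U
    refine IsKMSState.of_adjoin (dense_adjoin φ) ?_ hnonneg hone
      (generators_union_star_subset hfmem hUmem hU'mem)
    have hf_mem_adjoin : ∀ f, ofFunction φ f ∈
        StarAlgebra.adjoin ℂ (insert (U φ) (range (ofFunction φ))) :=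
      fun f => StarAlgebra.subset_adjoin ℂ _ (mem_insert_of_mem _ (mem_range_self f))
    rintro t _ (rfl | ⟨f, rfl⟩)
    · rw [crossedFlow_U]
      exact mul_mem (StarAlgebra.subset_adjoin ℂ _ (mem_insert _ _)) (hf_mem_adjoin _)
    · exact hf_mem_adjoin f

/-- The power `U ^ k`, `k ∈ ℤ`, of the canonical unitary. -/
noncomputable def UPow (φ : X ≃ₜ X) (k : ℤ) : CrossedProduct φ :=
  ((⟨U φ, U_mem_unitary φ⟩ : unitary (CrossedProduct φ)) ^ k : unitary (CrossedProduct φ))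

@[simp] theorem UPow_zero : UPow φ 0 = 1 := by simp [UPow]

theorem UPow_one : UPow φ 1 = U φ := by simp [UPow]

theorem UPow_neg_one : UPow φ (-1) = star (U φ) := by simp [UPow, ← Unitary.star_eq_inv]

theorem UPow_add (k l : ℤ) : UPow φ (k + l) = UPow φ k * UPow φ l := by simp [UPow, zpow_add]

theorem U_mul_ofFunction (f : C(X, ℂ)) :
    U φ * ofFunction φ f = ofFunction φ (koopman ℂ φ.symm f) * U φ := by
  change _ = ofFunction φ (f.comp φ.symm) * U φ
  rw [← U_covariant, mul_assoc, star_U_mul_U, mul_one]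

theorem star_U_mul_ofFunction (f : C(X, ℂ)) :
    star (U φ) * ofFunction φ f = ofFunction φ (koopman ℂ φ f) * star (U φ) := by
  have hcancel : koopman ℂ φ.symm (koopman ℂ φ f) = f := by
    ext x
    simp
  calc star (U φ) * ofFunction φ f
      = star (U φ) * (ofFunction φ (koopman ℂ φ.symm (koopman ℂ φ f)) * U φ) * star (U φ) := by
        rw [hcancel, mul_assoc, mul_assoc, U_mul_star_U, mul_one]
    _ = ofFunction φ (koopman ℂ φ f) * star (U φ) := by
        rw [← U_mul_ofFunction, ← mul_assoc, star_U_mul_U, one_mul]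

theorem UPow_mul_ofFunction (k : ℤ) (f : C(X, ℂ)) :
    UPow φ k * ofFunction φ f =
      ofFunction φ (koopman ℂ (φ ^ (-k) : X ≃ₜ X) f) * UPow φ k := by
  induction k generalizing f with
  | zero =>
    rw [UPow_zero, one_mul, mul_one]
    rfl
  | succ k ih =>
    rw [UPow_add, UPow_one, mul_assoc, U_mul_ofFunction, ← mul_assoc, ih, mul_assoc, neg_add_rev,
      zpow_add, zpow_neg_one]
    rfl
  | pred k ih =>
    rw [sub_eq_add_neg, UPow_add, UPow_neg_one, mul_assoc, star_U_mul_ofFunction, ← mul_assoc, ih,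
      mul_assoc, neg_add_rev, zpow_add, neg_neg, neg_neg, zpow_one]
    rfl

/-- The multiplicative monoid of the monomials `f U ^ k`. -/
def monomials (φ : X ≃ₜ X) : Submonoid (CrossedProduct φ) where
  carrier := range fun p : C(X, ℂ) × ℤ => ofFunction φ p.1 * UPow φ p.2
  mul_mem' := by
    rintro _ _ ⟨⟨f, k⟩, rfl⟩ ⟨⟨g, l⟩, rfl⟩
    refine ⟨⟨f * koopman ℂ (φ ^ (-k) : X ≃ₜ X) g, k + l⟩, ?_⟩
    simp only [map_mul, UPow_add, mul_assoc, ← mul_assoc (UPow φ k) (ofFunction φ g),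
      UPow_mul_ofFunction]
  one_mem' := ⟨(1, 0), by simp⟩

theorem ofFunction_mem_monomials (f : C(X, ℂ)) : ofFunction φ f ∈ monomials φ :=
  ⟨(f, 0), by simp⟩

theorem UPow_mem_monomials (k : ℤ) : UPow φ k ∈ monomials φ := ⟨(1, k), by simp⟩

theorem dense_span_monomials (φ : X ≃ₜ X) :
    Dense (Submodule.span ℂ (monomials φ : Set (CrossedProduct φ)) : Set (CrossedProduct φ)) := by
  have hgen : insert (U φ) (range (ofFunction φ)) ∪ star (insert (U φ) (range (ofFunction φ))) ⊆
      monomials φ :=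
    generators_union_star_subset ofFunction_mem_monomials
      (UPow_one (φ := φ) ▸ UPow_mem_monomials 1) (UPow_neg_one (φ := φ) ▸ UPow_mem_monomials (-1))
  refine (dense_adjoin φ).mono ?_
  rw [← StarSubalgebra.coe_toSubalgebra, StarAlgebra.adjoin_toSubalgebra,
    ← Subalgebra.coe_toSubmodule, Algebra.adjoin_eq_span]
  exact Submodule.span_mono (Submonoid.closure_le.2 hgen)

theorem functional_ext {ω₁ ω₂ : CrossedProduct φ →L[ℂ] ℂ}
    (h : ∀ f k, ω₁ (ofFunction φ f * UPow φ k) = ω₂ (ofFunction φ f * UPow φ k)) : ω₁ = ω₂ :=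
  ContinuousLinearMap.ext_on (dense_span_monomials φ) <| by
    rintro _ ⟨⟨f, k⟩, rfl⟩
    exact h f k

end CrossedProduct

section Complexify

variable {X : Type u} [TopologicalSpace X]

/-- The inclusion of the real-valued continuous functions into the complex-valued ones. -/
noncomputable def complexify : C(X, ℝ) →ₐ[ℝ] C(X, ℂ) :=
  Complex.ofRealAm.compLeftContinuous ℝ Complex.continuous_ofReal

@[simp] theorem complexify_apply (g : C(X, ℝ)) (x : X) : complexify g x = g x := rfl

theorem exists_eq_complexify_add (f : C(X, ℂ)) :
    ∃ g₁ g₂ : C(X, ℝ), f = complexify g₁ + I • complexify g₂ := by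
  refine ⟨⟨fun x => (f x).re, by fun_prop⟩, ⟨fun x => (f x).im, by fun_prop⟩, ?_⟩
  ext x
  simp [mul_comm I, Complex.re_add_im]

variable [CompactSpace X] {φ : X ≃ₜ X}

/-- The real functional `g ↦ Re ω(g)` that `ω` induces on the real-valued functions. -/
noncomputable def reFunctional (ω : CrossedProduct φ →L[ℂ] ℂ) : C(X, ℝ) →ₗ[ℝ] ℝ :=
  Complex.reLm ∘ₗ (ω : CrossedProduct φ →ₗ[ℂ] ℂ).restrictScalars ℝ ∘ₗ
    (CrossedProduct.ofFunction φ).toAlgHom.toLinearMap.restrictScalars ℝ ∘ₗ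
      complexify.toLinearMap

theorem reFunctional_apply (ω : CrossedProduct φ →L[ℂ] ℂ) (g : C(X, ℝ)) :
    reFunctional ω g = (ω (CrossedProduct.ofFunction φ (complexify g))).re := rfl

end Complexify

theorem koopman_zpow_of_apply_eq_smul {X 𝕜 : Type*} [TopologicalSpace X] [RCLike 𝕜] {φ : X ≃ₜ X}
    {e : C(X, 𝕜)} {c : 𝕜} (hc : c ≠ 0) (he : koopman 𝕜 φ e = c • e) (k : ℤ) :
    koopman 𝕜 (φ ^ k : X ≃ₜ X) e = c ^ k • e := by
  have happly : ∀ x, e (φ x) = c * e x := fun x => DFunLike.congr_fun he x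
  ext x
  change e ((φ ^ k) x) = c ^ k * e x
  induction k generalizing x with
  | zero => simp
  | succ k ih =>
    rw [zpow_add_one, zpow_add_one₀ hc, mul_assoc, ← happly]
    exact ih (φ x)
  | pred k ih =>
    rw [zpow_sub_one, zpow_sub_one₀ hc, mul_assoc]
    have hinv : e x = c * e (φ⁻¹ x) := by rw [← happly, Homeomorph.inv_apply, φ.apply_symm_apply]
    rw [hinv, inv_mul_cancel_left₀ hc]
    exact ih (φ⁻¹ x)

namespace IsKMSState

open CrossedProduct

section General

variable {X : Type u} [TopologicalSpace X] [CompactSpace X] {φ : X ≃ₜ X} {F : C(X, ℝ)} {β : ℝ}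
  {ω ω₁ ω₂ : CrossedProduct φ →L[ℂ] ℂ}

theorem apply_complexify_nonneg (hω : IsKMSState (crossedFlow φ F) β ω) {g : C(X, ℝ)}
    (hg : 0 ≤ g) : 0 ≤ ω (ofFunction φ (complexify g)) := by
  let r : C(X, ℝ) := ⟨fun x => √(g x), by fun_prop⟩
  have hr : complexify g = star (complexify r) * complexify r := by
    ext x
    have hsqrt : g x = r x * r x := (Real.mul_self_sqrt (hg x)).symm
    simp [hsqrt]
  rw [hr, map_mul, map_star]
  exact hω.nonneg _

theorem ofReal_reFunctional (hω : IsKMSState (crossedFlow φ F) β ω) (g : C(X, ℝ)) :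
    (reFunctional ω g : ℂ) = ω (ofFunction φ (complexify g)) := by
  refine Complex.ext rfl ?_
  have hshift : 0 ≤ g + ‖g‖ • 1 := fun x => by
    simpa [neg_le_iff_add_nonneg] using (abs_le.1 (g.norm_coe_le_norm x)).1
  have hone : complexify (‖g‖ • 1 : C(X, ℝ)) = (‖g‖ : ℂ) • 1 := by
    ext x
    simp
  have him := (Complex.le_def.1 (hω.apply_complexify_nonneg hshift)).2
  rw [map_add, hone, map_add, map_add, map_smul, map_smul,
    _root_.map_one (ofFunction φ), hω.map_one] at him
  simpa using him

theorem isConformal_reFunctional (hω : IsKMSState (crossedFlow φ F) β ω) :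
    IsConformal φ (β • F) (reFunctional ω) := by
  obtain ⟨-, hone, -, hU⟩ := isKMSState_iff.1 hω
  refine ⟨fun g hg => (Complex.le_def.1 (hω.apply_complexify_nonneg hg)).1, ?_, fun g => ?_⟩
  · rw [reFunctional_apply, _root_.map_one complexify, _root_.map_one (ofFunction φ), hone,
      Complex.one_re]
  · have hexp : complexify (expMap (β • F) * g) = complexify g * complexPhase F (I * β) := by
      ext x
      rw [ContinuousMap.mul_apply, complexPhase_I_mul]
      simp [mul_comm]
    have hcov := hU (ofFunction φ (complexify g) * star (U φ))
    rw [← mul_assoc, U_covariant, mul_assoc, ← mul_assoc (star (U φ)), star_U_mul_U, one_mul,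
      ← map_mul, ← hexp] at hcov
    exact congrArg Complex.re hcov

theorem apply_ofFunction_eq (h₁ : IsKMSState (crossedFlow φ F) β ω₁)
    (h₂ : IsKMSState (crossedFlow φ F) β ω₂) (heq : reFunctional ω₁ = reFunctional ω₂)
    (f : C(X, ℂ)) : ω₁ (ofFunction φ f) = ω₂ (ofFunction φ f) := by
  obtain ⟨g₁, g₂, rfl⟩ := exists_eq_complexify_add f
  simp only [map_add, map_smul, ← h₁.ofReal_reFunctional, ← h₂.ofReal_reFunctional, heq]

theorem apply_ofFunction_mul_UPow_eq_zero (hω : IsKMSState (crossedFlow φ F) β ω) {e : C(X, ℂ)}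
    (he : e * star e = 1) {c : ℂ} (hc : c ≠ 0) (hec : koopman ℂ φ e = c • e) {k : ℤ}
    (hck : c ^ (-k) ≠ 1) (f : C(X, ℂ)) : ω (ofFunction φ f * UPow φ k) = 0 := by
  obtain ⟨-, -, hf, -⟩ := isKMSState_iff.1 hω
  have hinvariant : ω (ofFunction φ f * UPow φ k) =
      c ^ (-k) * ω (ofFunction φ f * UPow φ k) :=
    calc ω (ofFunction φ f * UPow φ k)
        = ω (ofFunction φ e * (ofFunction φ (star e * f) * UPow φ k)) := by
          rw [← mul_assoc, ← map_mul, ← mul_assoc, he, one_mul]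
      _ = ω (ofFunction φ (star e * f) * (UPow φ k * ofFunction φ e)) := by rw [hf, mul_assoc]
      _ = c ^ (-k) * ω (ofFunction φ (star e * f) * ofFunction φ e * UPow φ k) := by
          rw [UPow_mul_ofFunction, koopman_zpow_of_apply_eq_smul hc hec, map_smul, smul_mul_assoc,
            mul_smul_comm, map_smul, smul_eq_mul, mul_assoc]
      _ = c ^ (-k) * ω (ofFunction φ f * UPow φ k) := by
          rw [← map_mul, mul_comm _ e, ← mul_assoc, he, one_mul]
  by_contra hne
  exact hck ((mul_eq_right₀ hne).1 hinvariant.symm)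

end General

variable {φ h : UnitAddCircle ≃ₜ UnitAddCircle} {α : ℝ} {F : C(UnitAddCircle, ℝ)} {β : ℝ}
  {ω ω₁ ω₂ : CrossedProduct φ →L[ℂ] ℂ}

theorem isConformal_circleRotation (hφ : φ = (h.symm.trans (circleRotation α)).trans h)
    (hω : IsKMSState (crossedFlow φ F) β ω) :
    IsConformal (circleRotation α) (β • koopman ℝ h F) (reFunctional ω ∘ₗ koopman ℝ h.symm) := by
  subst hφ
  rw [← map_smul]
  exact hω.isConformal_reFunctional.of_conj

theorem apply_ofFunction_mul_UPow_eq_zero_of_irrational (hα : Irrational α)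
    (hφ : φ = (h.symm.trans (circleRotation α)).trans h) (hω : IsKMSState (crossedFlow φ F) β ω)
    {k : ℤ} (hk : k ≠ 0) (f : C(UnitAddCircle, ℂ)) : ω (ofFunction φ f * UPow φ k) = 0 := by
  have hnorm (y : UnitAddCircle) : ‖(fourier 1 y : ℂ)‖ = 1 := by
    rw [fourier_apply, Circle.norm_coe]
  refine hω.apply_ofFunction_mul_UPow_eq_zero (e := koopman ℂ h.symm (fourier 1))
    (c := fourier 1 (α : UnitAddCircle)) ?_ ?_ ?_ ?_ f
  · ext x
    change (fourier 1 (h.symm x) : ℂ) * starRingEnd ℂ (fourier 1 (h.symm x)) = 1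
    rw [Complex.mul_conj', hnorm, Complex.ofReal_one, one_pow]
  · exact norm_ne_zero_iff.1 ((hnorm _).trans_ne one_ne_zero)
  · rw [← map_smul, ← koopman_circleRotation_fourier, hφ]
    ext x
    simp
  · have hpow : fourier 1 (α : UnitAddCircle) ^ (-k) = fourier (-k) (α : UnitAddCircle) := by
      rw [fourier_apply, fourier_apply, ← Circle.coe_zpow, ← AddCircle.toCircle_zsmul, one_smul]
    rw [hpow]
    exact fourier_coe_ne_one hα (neg_ne_zero.2 hk)

theorem unique (hα : Irrational α) (hφ : φ = (h.symm.trans (circleRotation α)).trans h)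
    (hF : BoundedVariationOn (fun t : ℝ => F (t : UnitAddCircle)) (Icc 0 1))
    (h₁ : IsKMSState (crossedFlow φ F) β ω₁) (h₂ : IsKMSState (crossedFlow φ F) β ω₂) :
    ω₁ = ω₂ := by
  obtain ⟨μ, hμ, hvar⟩ := exists_dominatesVariation hF
  have hcomp := IsConformal.eq_of_dominatesVariation hα (h₁.isConformal_circleRotation hφ)
    (h₂.isConformal_circleRotation hφ) ((hvar.koopman h).smul β)
  have heq : reFunctional ω₁ = reFunctional ω₂ := by
    ext g
    convert LinearMap.congr_fun hcomp (koopman ℝ h g) using 1 <;>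
    · rw [LinearMap.comp_apply]
      congr 1
      ext x
      simp
  refine functional_ext fun f k => ?_
  rcases eq_or_ne k 0 with rfl | hk
  · rw [UPow_zero, mul_one]
    exact h₁.apply_ofFunction_eq h₂ heq f
  · rw [h₁.apply_ofFunction_mul_UPow_eq_zero_of_irrational hα hφ hk,
      h₂.apply_ofFunction_mul_UPow_eq_zero_of_irrational hα hφ hk]

theorem integral_eq_zero (hα : Irrational α)
    (hφ : φ = (h.symm.trans (circleRotation α)).trans h)
    (hω : IsKMSState (crossedFlow φ F) β ω) (hβ : β ≠ 0) :
    ∫ x : UnitAddCircle, F (h x) = 0 := by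
  have hzero := (hω.isConformal_circleRotation hφ).eq_zero_of_tendsto_birkhoffAverage
    (tendsto_birkhoffAverage_circleRotation_real hα _)
  change ∫ x : UnitAddCircle, β * F (h x) = 0 at hzero
  rw [integral_const_mul] at hzero
  exact (mul_eq_zero.1 hzero).resolve_left hβ

end IsKMSState

section TwoSidedBirkhoffSum

variable {X : Type*} [TopologicalSpace X]

/-- The additive cocycle over the `ℤ`-action of `T` generated by `g`: the Birkhoff sum
`g x + ⋯ + g (T ^ (n - 1) x)` for `0 ≤ n`, and minus the corresponding sum over the past
for `n < 0`. -/
def twoSidedBirkhoffSum (T : X ≃ₜ X) (g : X → ℝ) (x : X) : ℤ → ℝ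
  | .ofNat m => birkhoffSum T g m x
  | .negSucc m => -birkhoffSum T.symm g (m + 1) (T.symm x)

theorem twoSidedBirkhoffSum_natCast (T : X ≃ₜ X) (g : X → ℝ) (x : X) (m : ℕ) :
    twoSidedBirkhoffSum T g x m = birkhoffSum T g m x := rfl

theorem twoSidedBirkhoffSum_neg_natCast (T : X ≃ₜ X) (g : X → ℝ) (x : X) (m : ℕ) :
    twoSidedBirkhoffSum T g x (-m) = -birkhoffSum T.symm g m (T.symm x) := by
  cases m with
  | zero => simpa using twoSidedBirkhoffSum_natCast T g x 0
  | succ m => rfl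

theorem homeomorph_pow_apply (T : X ≃ₜ X) (m : ℕ) (x : X) : (T ^ m) x = T^[m] x :=
  congrFun (hom_coe_pow _ rfl (fun _ _ => rfl) T m) x

theorem twoSidedBirkhoffSum_add_one (T : X ≃ₜ X) (g : X → ℝ) (x : X) (n : ℤ) :
    twoSidedBirkhoffSum T g x (n + 1) = twoSidedBirkhoffSum T g x n + g ((T ^ n) x) := by
  obtain ⟨m, rfl | hn⟩ : ∃ m : ℕ, n = m ∨ n + 1 = -m := by
    rcases le_or_gt 0 n with hn | hn
    · exact ⟨n.toNat, Or.inl (by lia)⟩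
    · exact ⟨(-n - 1).toNat, Or.inr (by lia)⟩
  · rw [← Nat.cast_succ, twoSidedBirkhoffSum_natCast, twoSidedBirkhoffSum_natCast,
      birkhoffSum_succ, zpow_natCast, homeomorph_pow_apply]
  · obtain rfl : n = -(m + 1 : ℕ) := by lia
    have hiterate : (T ^ (-(m + 1 : ℕ) : ℤ)) x = T.symm^[m] (T.symm x) := by
      rw [← inv_zpow', zpow_natCast, homeomorph_pow_apply]
      rfl
    rw [hn, twoSidedBirkhoffSum_neg_natCast, twoSidedBirkhoffSum_neg_natCast, birkhoffSum_succ,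
      hiterate, neg_add, neg_add_cancel_right]

theorem isLittleO_birkhoffSum_of_tendsto [CompactSpace X] {T : C(X, X)} {g : C(X, ℝ)}
    (hT : Tendsto (birkhoffAverage ℝ (koopman ℝ T) id · g) atTop (𝓝 0)) (x : X) :
    (birkhoffSum T g · x) =o[atTop] fun n : ℕ => (n : ℝ) := by
  refine (Asymptotics.isLittleO_iff_tendsto' ?_).2 ?_
  · filter_upwards [eventually_ne_atTop 0] with n hn hzero
    exact absurd hzero (Nat.cast_ne_zero.2 hn)
  · have heval := ((continuous_eval_const x).tendsto _).comp hT
    refine heval.congr fun n => ?_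
    rw [Function.comp_apply, birkhoffAverage, ContinuousMap.smul_apply, birkhoffSum_koopman_apply,
      smul_eq_mul, inv_mul_eq_div]

theorem isLittleO_twoSidedBirkhoffSum [CompactSpace X] {T : X ≃ₜ X} {g : C(X, ℝ)}
    (hT : Tendsto (birkhoffAverage ℝ (koopman ℝ T) id · g) atTop (𝓝 0))
    (hT' : Tendsto (birkhoffAverage ℝ (koopman ℝ T.symm) id · g) atTop (𝓝 0)) (x : X) :
    twoSidedBirkhoffSum T g x =o[cofinite] fun n : ℤ => (n : ℝ) := by
  rw [Int.cofinite_eq, ← map_neg_atTop, ← Nat.map_cast_int_atTop, map_map]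
  refine .sup (Asymptotics.isLittleO_map.2 ?_) (Asymptotics.isLittleO_map.2 ?_)
  · refine ((isLittleO_birkhoffSum_of_tendsto hT' (T.symm x)).neg_left.neg_right).congr
      (fun m => ?_) fun m => ?_
    · exact (twoSidedBirkhoffSum_neg_natCast T g x m).symm
    · simp
  · exact (isLittleO_birkhoffSum_of_tendsto hT x).congr (fun _ => rfl) fun m =>
      (Int.cast_natCast m).symm

end TwoSidedBirkhoffSum

section ApproximatelyConformalWeights

theorem summable_exp_neg_mul_abs_int {s : ℝ} (hs : 0 < s) :
    Summable fun n : ℤ => Real.exp (-s * |(n : ℝ)|) := by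
  have hnat : Summable fun n : ℕ => Real.exp (-s * n) := by
    simpa [mul_comm] using Real.summable_exp_nat_mul_iff.2 (neg_neg_of_pos hs)
  refine Summable.of_nat_of_neg ?_ ?_ <;> simpa using hnat

theorem summable_exp_sub_mul_abs_int {S : ℤ → ℝ} (hS : S =o[cofinite] fun n : ℤ => (n : ℝ)) {s : ℝ}
    (hs : 0 < s) : Summable fun n : ℤ => Real.exp (S n - s * |(n : ℝ)|) := by
  refine (summable_exp_neg_mul_abs_int (half_pos hs)).of_norm_bounded_eventually ?_
  filter_upwards [hS.def (half_pos hs)] with n hn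
  rw [Real.norm_eq_abs, Real.abs_exp, Real.exp_le_exp]
  rw [Real.norm_eq_abs, Real.norm_eq_abs] at hn
  linarith [le_of_abs_le hn]

theorem abs_one_sub_exp_log_mul_le {ε d : ℝ} (hε : 0 < ε) (hd : |d| ≤ 1) :
    |1 - Real.exp (Real.log (1 + ε) * d)| ≤ ε := by
  have hs : 0 < Real.log (1 + ε) := Real.log_pos (by linarith)
  have hexp : Real.exp (Real.log (1 + ε)) = 1 + ε := Real.exp_log (by linarith)
  obtain ⟨hd₁, hd₂⟩ := abs_le.1 hd
  have hupper : Real.exp (Real.log (1 + ε) * d) ≤ 1 + ε :=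
    (Real.exp_le_exp.2 (by nlinarith)).trans_eq hexp
  have hlower : Real.exp (-Real.log (1 + ε)) ≤ Real.exp (Real.log (1 + ε) * d) :=
    Real.exp_le_exp.2 (by nlinarith)
  have hinv : 1 - ε ≤ Real.exp (-Real.log (1 + ε)) := by
    rw [Real.exp_neg, hexp, ← one_div, le_div_iff₀ (by linarith)]
    nlinarith
  exact abs_le.2 ⟨by linarith, by linarith⟩

/-- A probability vector `p` on `ℤ` for which `p (n + 1) = exp (c n) * p n` holds up to a relative
error `ε`; for `c n = β F (φ ^ n x)` it is the density along the orbit of `x` of an approximately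
`exp (β F)`-conformal measure. -/
structure IsApproxConformalWeight (c : ℤ → ℝ) (ε : ℝ) (p : ℤ → ℝ) : Prop where
  nonneg : ∀ n, 0 ≤ p n
  hasSum : HasSum p 1
  abs_sub_le : ∀ n, |p (n + 1) - p n * Real.exp (c n)| ≤ ε * p (n + 1)

/-- Damping the exact solution `exp ∘ S` of the recurrence by `exp (-s |n|)`, `s = log (1 + ε)`,
makes it summable and changes the ratio of consecutive terms by a factor of at most `1 + ε`. -/
theorem exists_isApproxConformalWeight {S c : ℤ → ℝ} (hc : ∀ n, S (n + 1) = S n + c n)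
    (hS : S =o[cofinite] fun n : ℤ => (n : ℝ)) {ε : ℝ} (hε : 0 < ε) :
    ∃ p, IsApproxConformalWeight c ε p := by
  set s := Real.log (1 + ε)
  let r (n : ℤ) : ℝ := Real.exp (S n - s * |(n : ℝ)|)
  set Z := ∑' n, r n
  have hr (n : ℤ) : 0 < r n := Real.exp_pos _
  have hsum : Summable r := summable_exp_sub_mul_abs_int hS (Real.log_pos (by linarith))
  have hZ : 0 < Z := hsum.tsum_pos (fun n => (hr n).le) 0 (hr 0)
  have hp (n : ℤ) : 0 ≤ r n / Z := (div_pos (hr n) hZ).le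
  refine ⟨fun n => r n / Z, hp, ?_, fun n => ?_⟩
  · rw [← div_self hZ.ne']
    exact hsum.hasSum.div_const Z
  · set d := |((n + 1 : ℤ) : ℝ)| - |(n : ℝ)|
    have hd : |d| ≤ 1 := (abs_abs_sub_abs_le _ _).trans (by simp)
    have hstep : r n * Real.exp (c n) = r (n + 1) * Real.exp (s * d) := by
      simp only [r, d, ← Real.exp_add, hc]
      ring_nf
    calc |r (n + 1) / Z - r n / Z * Real.exp (c n)|
        = |(1 - Real.exp (s * d)) * (r (n + 1) / Z)| := by
          rw [div_mul_eq_mul_div, hstep]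
          ring_nf
      _ = |1 - Real.exp (s * d)| * (r (n + 1) / Z) := by rw [abs_mul, abs_of_nonneg (hp _)]
      _ ≤ ε * (r (n + 1) / Z) :=
          mul_le_mul_of_nonneg_right (abs_one_sub_exp_log_mul_le hε hd) (hp _)

theorem exists_isApproxConformalWeight_circleRotation {α : ℝ} (hα : Irrational α)
    {W : C(UnitAddCircle, ℝ)} (hW : ∫ x, W x = 0) (x : UnitAddCircle) {ε : ℝ} (hε : 0 < ε) :
    ∃ p, IsApproxConformalWeight (fun n => W ((circleRotation α ^ n : _ ≃ₜ _) x)) ε p := by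
  have hsymm : (circleRotation α).symm = circleRotation ((-α : ℝ) : UnitAddCircle) :=
    Homeomorph.ext fun _ => rfl
  have hforward := tendsto_birkhoffAverage_circleRotation_real hα W
  have hbackward := tendsto_birkhoffAverage_circleRotation_real hα.neg W
  rw [hW] at hforward hbackward
  rw [← hsymm] at hbackward
  exact exists_isApproxConformalWeight (twoSidedBirkhoffSum_add_one _ W x)
    (isLittleO_twoSidedBirkhoffSum hforward hbackward x) hε

end ApproximatelyConformalWeights

section OrbitRepresentation

/-- The unitary `ξ ↦ ξ ∘ σ` of `ℓ²(ι)`. -/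
noncomputable def permUnitary {ι : Type*} (σ : Equiv.Perm ι) : ℓ²(ι, ℂ) ≃ₗᵢ[ℂ] ℓ²(ι, ℂ) :=
  have hmem (σ : Equiv.Perm ι) (ξ : ℓ²(ι, ℂ)) : Memℓp (fun i => ξ (σ i)) 2 :=
    (memℓp_gen_iff (by simp)).2 <|
      (σ.summable_iff (f := fun i => ‖ξ i‖ ^ (2 : ℝ≥0∞).toReal)).2 <|
        (lp.memℓp ξ).summable (by simp)
  { toFun ξ := ⟨fun i => ξ (σ i), hmem σ ξ⟩
    invFun ξ := ⟨fun i => ξ (σ.symm i), hmem σ.symm ξ⟩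
    left_inv ξ := by ext i; simp
    right_inv ξ := by ext i; simp
    map_add' ξ η := rfl
    map_smul' c ξ := rfl
    norm_map' ξ := by
      rw [lp.norm_eq_tsum_rpow (by simp), lp.norm_eq_tsum_rpow (by simp)]
      exact congrArg (· ^ _) (σ.tsum_eq fun i => ‖ξ i‖ ^ (2 : ℝ≥0∞).toReal) }

/-- The representation of `C(X)` on `ℓ²(ι)` by the multiplication operators `ξ ↦ (f ∘ x) ξ`. -/
noncomputable def diagonalRep {ι X : Type*} [TopologicalSpace X] [CompactSpace X] (x : ι → X) :
    C(X, ℂ) →⋆ₐ[ℂ] (ℓ²(ι, ℂ) →L[ℂ] ℓ²(ι, ℂ)) where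
  toFun f := lp.mapCLM 2 (fun i => f (x i) • .id ℂ ℂ) (norm_nonneg f) fun i => by
    simpa [norm_smul] using f.norm_coe_le_norm (x i)
  map_one' := by ext ξ i; simp [lp.mapCLM]
  map_mul' f g := by ext ξ i; simp [lp.mapCLM, mul_assoc]
  map_zero' := by ext ξ i; simp [lp.mapCLM]
  map_add' f g := by ext ξ i; exact add_mul (f (x i)) (g (x i)) (ξ i)
  commutes' c := by ext ξ i; simp [lp.mapCLM, Algebra.algebraMap_eq_smul_one]
  map_star' f := by
    rw [ContinuousLinearMap.star_eq_adjoint, ContinuousLinearMap.eq_adjoint_iff]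
    intro ξ η
    rw [lp.inner_eq_tsum, lp.inner_eq_tsum]
    refine tsum_congr fun i => ?_
    simp [lp.mapCLM, mul_left_comm, mul_assoc]

/-- Unit vectors `δ n` that a representation of the crossed product permutes like the points `x n`
of an orbit: functions act on `δ n` through their value at `x n`, and `U` maps `δ n` to
`δ (n + 1)`. -/
structure IsOrbitFamily {X : Type u} [TopologicalSpace X] [CompactSpace X] {φ : X ≃ₜ X}
    {H : Type*} [NormedAddCommGroup H] [InnerProductSpace ℂ H] [CompleteSpace H]
    (ψ : CrossedProduct φ →⋆ₐ[ℂ] (H →L[ℂ] H)) (x : ℤ → X) (δ : ℤ → H) :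
    Prop where
  norm_eq_one : ∀ n, ‖δ n‖ = 1
  ofFunction_apply : ∀ f n, ψ (CrossedProduct.ofFunction φ f) (δ n) = f (x n) • δ n
  U_apply : ∀ n, ψ (CrossedProduct.U φ) (δ n) = δ (n + 1)

variable {X : Type} [TopologicalSpace X] [CompactSpace X] {φ : X ≃ₜ X}

/-- The covariant representation on `ℓ²(ℤ)` given by the orbit `x` of `φ`. -/
noncomputable def orbitRep (x : ℤ → X) (hx : ∀ n, φ (x n) = x (n + 1)) : CovariantRep φ where
  B := ℓ²(ℤ, ℂ) →L[ℂ] ℓ²(ℤ, ℂ)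
  nontriv :=
    have : Nontrivial ℓ²(ℤ, ℂ) :=
      nontrivial_of_ne (lp.single 2 0 1) 0 (norm_ne_zero_iff.1 (by simp [lp.norm_single]))
    inferInstance
  π := diagonalRep x
  u := Unitary.linearIsometryEquiv.symm (permUnitary (Equiv.subRight (1 : ℤ)))
  mem_unitary := SetLike.coe_mem _
  covariant f := by
    set V := Unitary.linearIsometryEquiv.symm (permUnitary (Equiv.subRight (1 : ℤ)))
    have hcomm : (V : ℓ²(ℤ, ℂ) →L[ℂ] ℓ²(ℤ, ℂ)) * diagonalRep x f =
        diagonalRep x (f.comp (φ.symm : C(X, X))) * V := by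
      ext ξ n
      have hxn : φ.symm (x n) = x (n - 1) := by
        rw [Homeomorph.symm_apply_eq, hx, sub_add_cancel]
      change f (x (n - 1)) * ξ (n - 1) = f (φ.symm (x n)) * ξ (n - 1)
      rw [hxn]
    rw [hcomm, mul_assoc, Unitary.mul_star_self_of_mem V.2, mul_one]

theorem exists_isOrbitFamily (x : ℤ → X) (hx : ∀ n, φ (x n) = x (n + 1)) :
    ∃ (ψ : CrossedProduct φ →⋆ₐ[ℂ] (ℓ²(ℤ, ℂ) →L[ℂ] ℓ²(ℤ, ℂ))) (δ : ℤ → ℓ²(ℤ, ℂ)),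
      IsOrbitFamily ψ x δ := by
  obtain ⟨ψ, hfun, hU⟩ : ∃ ψ : CrossedProduct φ →⋆ₐ[ℂ] (ℓ²(ℤ, ℂ) →L[ℂ] ℓ²(ℤ, ℂ)),
      (∀ f, ψ (CrossedProduct.ofFunction φ f) = diagonalRep x f) ∧
        ψ (CrossedProduct.U φ) = permUnitary (Equiv.subRight (1 : ℤ)) :=
    (CrossedProduct.existsUnique_lift (orbitRep x hx)).exists
  refine ⟨ψ, fun n => lp.single 2 n 1, fun n => by simp [lp.norm_single], fun f n => ?_,
    fun n => ?_⟩
  · rw [hfun]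
    ext m
    change f (x m) * _ = f (x n) * _
    rcases eq_or_ne m n with rfl | hmn
    · rfl
    · simp [Pi.single_eq_of_ne hmn]
  · rw [hU]
    ext m
    change lp.single (E := fun _ : ℤ => ℂ) 2 n 1 (m - 1) = _
    simp [Pi.single_apply, sub_eq_iff_eq_add]

end OrbitRepresentation

section VectorStates

variable {A H : Type*} [CStarAlgebra A] [NormedAddCommGroup H] [InnerProductSpace ℂ H]
  [CompleteSpace H] (ψ : A →⋆ₐ[ℂ] (H →L[ℂ] H))

theorem norm_inner_apply_le (ξ η : H) (a : A) : ‖⟪ξ, ψ a η⟫_ℂ‖ ≤ ‖ξ‖ * ‖η‖ * ‖a‖ :=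
  calc ‖⟪ξ, ψ a η⟫_ℂ‖ ≤ ‖ξ‖ * ‖ψ a η‖ := norm_inner_le_norm _ _
    _ ≤ ‖ξ‖ * (‖a‖ * ‖η‖) := by
      gcongr
      exact (ψ a).le_of_opNorm_le (NonUnitalStarAlgHom.norm_apply_le ψ a) η
    _ = ‖ξ‖ * ‖η‖ * ‖a‖ := by ring

theorem inner_apply_star_mul (ξ η : H) (a b : A) :
    ⟪ξ, ψ (star a * b) η⟫_ℂ = ⟪ψ a ξ, ψ b η⟫_ℂ := by
  rw [map_mul, map_star, ContinuousLinearMap.star_eq_adjoint]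
  exact ContinuousLinearMap.adjoint_inner_right (ψ a) ξ (ψ b η)

/-- The functional `a ↦ ⟪ξ, ψ a ξ⟫`. -/
noncomputable def vectorFunctional (ξ : H) : A →L[ℂ] ℂ :=
  (((innerSL ℂ ξ ∘L ContinuousLinearMap.apply ℂ H ξ : (H →L[ℂ] H) →L[ℂ] ℂ) :
    (H →L[ℂ] H) →ₗ[ℂ] ℂ) ∘ₗ ψ.toAlgHom.toLinearMap).mkContinuous
    (‖ξ‖ * ‖ξ‖) (norm_inner_apply_le ψ ξ ξ)

theorem vectorFunctional_apply (ξ : H) (a : A) : vectorFunctional ψ ξ a = ⟪ξ, ψ a ξ⟫_ℂ := rfl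

/-- The mixture with weights `p` of the functionals `a ↦ ⟪δ n, ψ a (δ n)⟫`. -/
noncomputable def mixedFunctional (p : ℤ → ℝ) (δ : ℤ → H) : A →L[ℂ] ℂ :=
  ∑' n, (p n : ℂ) • vectorFunctional ψ (δ n)

variable {ψ} {p : ℤ → ℝ} {δ : ℤ → H}

theorem norm_smul_vectorFunctional_le (hp : ∀ n, 0 ≤ p n) (hδ : ∀ n, ‖δ n‖ = 1) (n : ℤ) :
    ‖(p n : ℂ) • vectorFunctional ψ (δ n)‖ ≤ p n := by
  have hle : ‖vectorFunctional ψ (δ n)‖ ≤ 1 := by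
    refine (LinearMap.mkContinuous_norm_le _ (by positivity) _).trans_eq ?_
    rw [hδ, one_mul]
  rw [norm_smul, Complex.norm_real, Real.norm_of_nonneg (hp n)]
  exact mul_le_of_le_one_right (hp n) hle

theorem norm_mixedFunctional_le (hp : ∀ n, 0 ≤ p n) (hsum : HasSum p 1) (hδ : ∀ n, ‖δ n‖ = 1) :
    ‖mixedFunctional ψ p δ‖ ≤ 1 :=
  tsum_of_norm_bounded hsum (norm_smul_vectorFunctional_le hp hδ)

theorem hasSum_mixedFunctional (hp : ∀ n, 0 ≤ p n) (hsum : HasSum p 1) (hδ : ∀ n, ‖δ n‖ = 1)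
    (a : A) : HasSum (fun n => p n * ⟪δ n, ψ a (δ n)⟫_ℂ) (mixedFunctional ψ p δ a) := by
  have hsummable := hsum.summable.of_norm_bounded (norm_smul_vectorFunctional_le (ψ := ψ) hp hδ)
  rw [mixedFunctional]
  simpa only [Function.comp_def, ContinuousLinearMap.apply_apply, smul_apply,
    vectorFunctional_apply, smul_eq_mul] using
    (ContinuousLinearMap.apply ℂ ℂ a).hasSum hsummable.hasSum

theorem mixedFunctional_star_mul_self_nonneg (hp : ∀ n, 0 ≤ p n) (hsum : HasSum p 1)
    (hδ : ∀ n, ‖δ n‖ = 1) (a : A) : 0 ≤ mixedFunctional ψ p δ (star a * a) := by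
  refine (hasSum_mixedFunctional hp hsum hδ (star a * a)).nonneg fun n => ?_
  have hinner : ⟪δ n, ψ (star a * a) (δ n)⟫_ℂ = (‖ψ a (δ n)‖ ^ 2 : ℝ) := by
    rw [inner_apply_star_mul, inner_self_eq_norm_sq_to_K, Complex.ofReal_pow]
    rfl
  rw [hinner, ← Complex.ofReal_mul]
  exact Complex.zero_le_real.2 (mul_nonneg (hp n) (sq_nonneg _))

theorem mixedFunctional_one (hp : ∀ n, 0 ≤ p n) (hsum : HasSum p 1) (hδ : ∀ n, ‖δ n‖ = 1) :
    mixedFunctional ψ p δ 1 = 1 := by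
  refine (hasSum_mixedFunctional hp hsum hδ 1).unique ?_
  simpa [inner_self_eq_norm_sq_to_K, hδ] using Complex.hasSum_ofReal.2 hsum

end VectorStates

open CrossedProduct

section OrbitMixtures

variable {X : Type u} [TopologicalSpace X] [CompactSpace X] {φ : X ≃ₜ X}

/-- A state of the crossed product that satisfies the `β`-KMS condition for `crossedFlow φ F`
against functions, and against `U` up to the error `ε`. -/
structure IsApproxKMSState (F : C(X, ℝ)) (β ε : ℝ) (ω : CrossedProduct φ →L[ℂ] ℂ) : Prop where
  norm_le_one : ‖ω‖ ≤ 1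
  nonneg : ∀ a, 0 ≤ ω (star a * a)
  map_one : ω 1 = 1
  map_ofFunction_mul : ∀ f b, ω (ofFunction φ f * b) = ω (b * ofFunction φ f)
  norm_map_U_mul_sub_le : ∀ b,
    ‖ω (U φ * b) - ω (b * (U φ * ofFunction φ (complexPhase F (I * β))))‖ ≤ ε * ‖b‖

namespace IsOrbitFamily

variable {H : Type*} [NormedAddCommGroup H] [InnerProductSpace ℂ H] [CompleteSpace H]
  {ψ : CrossedProduct φ →⋆ₐ[ℂ] (H →L[ℂ] H)} {x : ℤ → X} {δ : ℤ → H}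

theorem inner_ofFunction_mul (hδ : IsOrbitFamily ψ x δ) (f : C(X, ℂ)) (b : CrossedProduct φ)
    (n : ℤ) : ⟪δ n, ψ (ofFunction φ f * b) (δ n)⟫_ℂ = f (x n) * ⟪δ n, ψ b (δ n)⟫_ℂ := by
  rw [← star_star f, map_star, inner_apply_star_mul, hδ.ofFunction_apply, inner_smul_left]
  rfl

theorem inner_mul_ofFunction (hδ : IsOrbitFamily ψ x δ) (f : C(X, ℂ)) (b : CrossedProduct φ)
    (m n : ℤ) : ⟪δ m, ψ (b * ofFunction φ f) (δ n)⟫_ℂ = f (x n) * ⟪δ m, ψ b (δ n)⟫_ℂ := by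
  rw [map_mul, mul_apply_eq_comp, hδ.ofFunction_apply, map_smul, inner_smul_right]

theorem inner_U_mul (hδ : IsOrbitFamily ψ x δ) (b : CrossedProduct φ) (n : ℤ) :
    ⟪δ (n + 1), ψ (U φ * b) (δ (n + 1))⟫_ℂ = ⟪δ n, ψ b (δ (n + 1))⟫_ℂ := by
  have hU : star (U φ) * (U φ * b) = b := by
    rw [← mul_assoc, Unitary.star_mul_self_of_mem (U_mem_unitary φ), one_mul]
  rw [← hδ.U_apply n, ← inner_apply_star_mul, hU]

theorem inner_mul_U (hδ : IsOrbitFamily ψ x δ) (b : CrossedProduct φ) (m n : ℤ) :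
    ⟪δ m, ψ (b * U φ) (δ n)⟫_ℂ = ⟪δ m, ψ b (δ (n + 1))⟫_ℂ := by
  rw [map_mul, mul_apply_eq_comp, hδ.U_apply]

theorem inner_mul_U_mul_complexPhase (hδ : IsOrbitFamily ψ x δ) (F : C(X, ℝ)) (β : ℝ)
    (b : CrossedProduct φ) (n : ℤ) :
    ⟪δ n, ψ (b * (U φ * ofFunction φ (complexPhase F (I * β)))) (δ n)⟫_ℂ =
      Complex.exp (β * F (x n)) * ⟪δ n, ψ b (δ (n + 1))⟫_ℂ := by
  rw [← mul_assoc, hδ.inner_mul_ofFunction, hδ.inner_mul_U, complexPhase_I_mul]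

theorem norm_mixedFunctional_U_mul_sub_le (hδ : IsOrbitFamily ψ x δ) {F : C(X, ℝ)} {β ε : ℝ}
    {p : ℤ → ℝ} (hp : IsApproxConformalWeight (fun n => β * F (x n)) ε p)
    (b : CrossedProduct φ) :
    ‖mixedFunctional ψ p δ (U φ * b) -
      mixedFunctional ψ p δ (b * (U φ * ofFunction φ (complexPhase F (I * β))))‖ ≤ ε * ‖b‖ := by
  let c (n : ℤ) : ℂ := ⟪δ n, ψ b (δ (n + 1))⟫_ℂ
  have hc (n : ℤ) : ‖c n‖ ≤ ‖b‖ := by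
    simpa only [hδ.norm_eq_one, one_mul] using norm_inner_apply_le ψ (δ n) (δ (n + 1)) b
  have hsum := hasSum_mixedFunctional (ψ := ψ) hp.nonneg hp.hasSum hδ.norm_eq_one
  have hleft : HasSum (fun n => p (n + 1) * c n) (mixedFunctional ψ p δ (U φ * b)) := by
    have hshift := hsum (U φ * b)
    rw [← (Equiv.addRight (1 : ℤ)).hasSum_iff] at hshift
    simpa only [Function.comp_def, Equiv.coe_addRight, hδ.inner_U_mul] using hshift
  have hright := hsum (b * (U φ * ofFunction φ (complexPhase F (I * β))))
  simp only [hδ.inner_mul_U_mul_complexPhase F β b] at hright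
  have hbound : HasSum (fun n => ε * p (n + 1) * ‖b‖) (ε * ‖b‖) := by
    simpa only [Function.comp_def, Equiv.coe_addRight, mul_one] using
      (((Equiv.addRight (1 : ℤ)).hasSum_iff.2 hp.hasSum).mul_left ε).mul_right ‖b‖
  rw [← (hleft.sub hright).tsum_eq]
  refine tsum_of_norm_bounded hbound fun n => ?_
  have hterm : p (n + 1) * c n - p n * (Complex.exp (β * F (x n)) * c n) =
      ((p (n + 1) - p n * Real.exp (β * F (x n)) : ℝ) : ℂ) * c n := by
    push_cast
    ring
  rw [hterm, norm_mul, Complex.norm_real, Real.norm_eq_abs]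
  exact mul_le_mul (hp.abs_sub_le n) (hc n) (norm_nonneg _)
    ((abs_nonneg _).trans (hp.abs_sub_le n))

theorem isApproxKMSState_mixedFunctional (hδ : IsOrbitFamily ψ x δ) {F : C(X, ℝ)} {β ε : ℝ}
    {p : ℤ → ℝ} (hp : IsApproxConformalWeight (fun n => β * F (x n)) ε p) :
    IsApproxKMSState F β ε (mixedFunctional ψ p δ) where
  norm_le_one := norm_mixedFunctional_le hp.nonneg hp.hasSum hδ.norm_eq_one
  nonneg := mixedFunctional_star_mul_self_nonneg hp.nonneg hp.hasSum hδ.norm_eq_one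
  map_one := mixedFunctional_one hp.nonneg hp.hasSum hδ.norm_eq_one
  map_ofFunction_mul f b := by
    have hsum := hasSum_mixedFunctional (ψ := ψ) hp.nonneg hp.hasSum hδ.norm_eq_one
    refine (hsum (ofFunction φ f * b)).unique ?_
    simpa only [hδ.inner_ofFunction_mul, hδ.inner_mul_ofFunction] using hsum (b * ofFunction φ f)
  norm_map_U_mul_sub_le := hδ.norm_mixedFunctional_U_mul_sub_le hp

end IsOrbitFamily

end OrbitMixtures

section Existence

theorem exists_tendsto_apply_of_norm_le_one {E : Type*} [NormedAddCommGroup E] [NormedSpace ℂ E]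
    {ω : ℕ → E →L[ℂ] ℂ} (hω : ∀ k, ‖ω k‖ ≤ 1) :
    ∃ (ω₀ : E →L[ℂ] ℂ) (𝒰 : Ultrafilter ℕ), ↑𝒰 ≤ (atTop : Filter ℕ) ∧
      ∀ a, Tendsto (fun k => ω k a) 𝒰 (𝓝 (ω₀ a)) := by
  have hmem : ∀ k, StrongDual.toWeakDual (ω k) ∈
      WeakDual.toStrongDual ⁻¹' Metric.closedBall (0 : StrongDual ℂ E) 1 := by
    simpa using hω
  obtain ⟨ω₀, -, hlim⟩ := (WeakDual.isCompact_closedBall (𝕜 := ℂ) (E := E) 0 1).ultrafilter_le_nhds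
    ((Ultrafilter.of atTop).map fun k => StrongDual.toWeakDual (ω k))
    (tendsto_principal.2 (Eventually.of_forall hmem))
  exact ⟨WeakDual.toStrongDual ω₀, Ultrafilter.of atTop, Ultrafilter.of_le atTop,
    fun a => ((WeakDual.eval_continuous a).tendsto ω₀).comp hlim⟩

theorem exists_isKMSState_of_isApproxKMSState {X : Type u} [TopologicalSpace X] [CompactSpace X]
    {φ : X ≃ₜ X} {F : C(X, ℝ)} {β : ℝ}
    (hF : ∀ ε > 0, ∃ ω : CrossedProduct φ →L[ℂ] ℂ, IsApproxKMSState F β ε ω) :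
    ∃ ω : CrossedProduct φ →L[ℂ] ℂ, IsKMSState (crossedFlow φ F) β ω := by
  choose ω hω using fun k : ℕ => hF (1 / ((k : ℝ) + 1)) Nat.one_div_pos_of_nat
  obtain ⟨ω₀, 𝒰, h𝒰, hlim⟩ := exists_tendsto_apply_of_norm_le_one fun k => (hω k).norm_le_one
  refine ⟨ω₀, isKMSState_iff.2 ⟨fun a => ?_, ?_, fun f b => ?_, fun b => ?_⟩⟩
  · exact ge_of_tendsto' (hlim _) fun k => (hω k).nonneg a
  · refine tendsto_nhds_unique (hlim 1) ?_
    simp only [(hω _).map_one, tendsto_const_nhds]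
  · refine tendsto_nhds_unique (hlim _) ?_
    simpa only [(hω _).map_ofFunction_mul] using hlim (b * ofFunction φ f)
  · have herror : Tendsto (fun k : ℕ => 1 / ((k : ℝ) + 1) * ‖b‖) 𝒰 (𝓝 0) := by
      simpa only [zero_mul] using
        ((tendsto_one_div_add_atTop_nhds_zero_nat (𝕜 := ℝ)).mul_const ‖b‖).mono_left h𝒰
    exact sub_eq_zero.1 <| tendsto_nhds_unique ((hlim _).sub (hlim _)) <|
      squeeze_zero_norm (fun k => (hω k).norm_map_U_mul_sub_le b) herror

theorem exists_isKMSState {φ h : UnitAddCircle ≃ₜ UnitAddCircle} {α : ℝ} (hα : Irrational α)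
    (hφ : φ = (h.symm.trans (circleRotation α)).trans h) {F : C(UnitAddCircle, ℝ)}
    (hF : ∫ x, F (h x) = 0) (β : ℝ) :
    ∃ ω : CrossedProduct φ →L[ℂ] ℂ, IsKMSState (crossedFlow φ F) β ω := by
  let x (n : ℤ) : UnitAddCircle := h ((circleRotation α ^ n : _ ≃ₜ _) 0)
  have hx (n : ℤ) : φ (x n) = x (n + 1) := by
    simp only [hφ, x, Homeomorph.trans_apply, Homeomorph.symm_apply_apply, add_comm n 1,
      zpow_one_add]
    rfl
  have hW : ∫ y, (β • F.comp (h : C(UnitAddCircle, UnitAddCircle))) y = 0 := by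
    simp [integral_const_mul, hF]
  obtain ⟨ψ, δ, hδ⟩ := exists_isOrbitFamily x hx
  refine exists_isKMSState_of_isApproxKMSState fun ε hε => ?_
  obtain ⟨p, hp⟩ := exists_isApproxConformalWeight_circleRotation hα hW 0 hε
  exact ⟨mixedFunctional ψ p δ, hδ.isApproxKMSState_mixedFunctional hp⟩

end Existence

theorem theorem5p4 (φ h : UnitAddCircle ≃ₜ UnitAddCircle) (α : ℝ) (hα : Irrational α)
    (hφ : φ = (h.symm.trans (Homeomorph.addRight (α : UnitAddCircle))).trans h)
    (F : C(UnitAddCircle, ℝ)) :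
    ((∃ β : ℝ, β ≠ 0 ∧ ∃ ω : CrossedProduct φ →L[ℂ] ℂ, IsKMSState (crossedFlow φ F) β ω) ↔
      ∫ x : UnitAddCircle, F (h x) = 0) ∧
    (∫ x : UnitAddCircle, F (h x) = 0 →
      ∀ β : ℝ, ∃ ω : CrossedProduct φ →L[ℂ] ℂ, IsKMSState (crossedFlow φ F) β ω) ∧
    (BoundedVariationOn (fun t : ℝ => F (t : UnitAddCircle)) (Set.Icc 0 1) →
      ∀ β : ℝ, ∀ ω₁ ω₂ : CrossedProduct φ →L[ℂ] ℂ, IsKMSState (crossedFlow φ F) β ω₁ →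
        IsKMSState (crossedFlow φ F) β ω₂ → ω₁ = ω₂) := by
  refine ⟨⟨?_, fun hF => ⟨1, one_ne_zero, exists_isKMSState hα hφ hF 1⟩⟩,
    fun hF β => exists_isKMSState hα hφ hF β,
    fun hF β ω₁ ω₂ h₁ h₂ => h₁.unique hα hφ hF h₂⟩
  rintro ⟨β, hβ, ω, hω⟩
  exact hω.integral_eq_zero hα hφ hβ
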